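/- Let $M$ be a connected smooth manifold (without boundary) of dimension $2m\ge 6$ with an almost Hermitian structure: a smooth Riemannian metric $g$ and a smooth field $J$ of endomorphisms of the tangent spaces with $J^2=-\mathrm{id}$ and $g(Jx,Jy)=g(x,y)$. Let $\nabla$ be the Levi-Civita connection of $g$ and $R(x,y,z,u)=g\big(\nabla_x\nabla_y z-\nabla_y\nabla_x z-\nabla_{[x,y]}z,\,u\big)$ its curvature tensor; the sectional curvature of a 2-plane $\alpha\subset T_pM$ with orthonormal basis $\{x,y\}$ is $K(\alpha)=R(x,y,y,x)$, and $\alpha$ is called antiholomorphic if $g(x,Jy)=0$, that is, if $\alpha\perp J\alpha$. Suppose that $M$ is an RK-manifold, i.e. $R(x,y,z,u)=R(Jx,Jy,Jz,Ju)$ for all $p\in M$ and $x,y,z,u\in T_pM$, and that $M$ has pointwise constant antiholomorphic sectional curvature, i.e. for every $p\in M$ there is a number $\nu(p)$ with $K(\alpha)=\nu(p)$ for every antiholomorphic 2-plane $\alpha\subset T_pM$. Then $M$ has constant antiholomorphic sectional curvature: there is a constant $c$ such that $K(\alpha)=c$ for every $p\in M$ and every antiholomorphic 2-plane $\alpha\subset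 T_pM$; in other words, $\nu$ is constant. -/

import Mathlib

open Bundle Manifold
open scoped ContDiff

noncomputable section

/-! ### Levi-Civita connection and curvature of a metric on a vector space, in coordinates -/

section Coordinates

variable {E : Type*} [NormedAddCommGroup E] [NormedSpace ℝ E]

/-- The Christoffel map `Γ_q(x, y)` of a field `G` of inner products on `E`, that is `∇_x y` at `q`
for the constant vector fields `x`, `y`. It is the vector determined by
`G_q(Γ_q(x, y), w) = (∂_x G(y, w) + ∂_y G(x, w) - ∂_w G(x, y)) / 2` for all `w`;
the covector on the right is turned into a vector by the inverse of `v ↦ G_q(v, ·)`. -/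
def christoffel (G : E → E →L[ℝ] E →L[ℝ] ℝ) (q x y : E) : E :=
  (G q).inverse ((1 / 2 : ℝ) • (fderiv ℝ G q x y + fderiv ℝ G q y x
    - ((fderiv ℝ G q).flip x).flip y))

/-- The curvature operator `R(x, y)z = ∇_x ∇_y z - ∇_y ∇_x z` of `G` at `q`, for constant vector
fields `x`, `y`, `z` (so that `[x, y] = 0`). -/
def coordCurvature (G : E → E →L[ℝ] E →L[ℝ] ℝ) (q x y z : E) : E :=
  fderiv ℝ (fun r ↦ christoffel G r y z) q x - fderiv ℝ (fun r ↦ christoffel G r x z) q y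
    + christoffel G q x (christoffel G q y z) - christoffel G q y (christoffel G q x z)

end Coordinates

/-! ### Riemannian manifolds -/

section Riemannian

variable {E : Type*} [NormedAddCommGroup E] [NormedSpace ℝ E]
  {M : Type*} [TopologicalSpace M] [ChartedSpace E M] [IsManifold 𝓘(ℝ, E) ∞ M]

/-- The metric `g` read in the chart `φ` around `p`: the field
`q ↦ g_{φ⁻¹ q}(dφ⁻¹ v, dφ⁻¹ w)` of bilinear forms on the model space. -/
def metricInChart (g : ContMDiffRiemannianMetric 𝓘(ℝ, E) ∞ E
      (fun p : M ↦ TangentSpace 𝓘(ℝ, E) p)) (p : M) (q : E) : E →L[ℝ] E →L[ℝ] ℝ :=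
  let d : E →L[ℝ] TangentSpace 𝓘(ℝ, E) ((extChartAt 𝓘(ℝ, E) p).symm q) :=
    mfderiv 𝓘(ℝ, E) 𝓘(ℝ, E) (extChartAt 𝓘(ℝ, E) p).symm q
  (ContinuousLinearMap.precomp ℝ d).comp ((g.inner ((extChartAt 𝓘(ℝ, E) p).symm q)).comp d)

/-- The curvature tensor `R(x, y, z, u) = g(R(x, y)z, u)` of the Levi-Civita connection of `g`
at `p`, computed in the chart `φ` around `p` through `dφ_p`. -/
def curvatureTensor (g : ContMDiffRiemannianMetric 𝓘(ℝ, E) ∞ E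
      (fun p : M ↦ TangentSpace 𝓘(ℝ, E) p)) (p : M) (x y z u : TangentSpace 𝓘(ℝ, E) p) : ℝ :=
  let q : E := extChartAt 𝓘(ℝ, E) p p
  let d : TangentSpace 𝓘(ℝ, E) p →L[ℝ] E :=
    mfderiv 𝓘(ℝ, E) 𝓘(ℝ, E) (extChartAt 𝓘(ℝ, E) p) p
  metricInChart g p q (coordCurvature (metricInChart g p) q (d x) (d y) (d z)) (d u)

end Riemannian

/-! ### Almost Hermitian manifolds -/

/-- An almost Hermitian structure on a smooth manifold: a smooth Riemannian metric `g` and a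
smooth field `J` of endomorphisms of the tangent spaces with `J² = -1` and `g(Jx, Jy) = g(x, y)`. -/
structure AlmostHermitianStructure (E : Type*) [NormedAddCommGroup E] [NormedSpace ℝ E]
    (M : Type*) [TopologicalSpace M] [ChartedSpace E M] [IsManifold 𝓘(ℝ, E) ∞ M] where
  g : ContMDiffRiemannianMetric 𝓘(ℝ, E) ∞ E (fun p : M ↦ TangentSpace 𝓘(ℝ, E) p)
  J (p : M) : TangentSpace 𝓘(ℝ, E) p →L[ℝ] TangentSpace 𝓘(ℝ, E) p
  J_J (p : M) (x : TangentSpace 𝓘(ℝ, E) p) : J p (J p x) = -x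
  g_J_J (p : M) (x y : TangentSpace 𝓘(ℝ, E) p) : g.inner p (J p x) (J p y) = g.inner p x y
  contMDiff_J : ContMDiff 𝓘(ℝ, E) (𝓘(ℝ, E).prod 𝓘(ℝ, E →L[ℝ] E)) ∞
    (fun p ↦ TotalSpace.mk' (E →L[ℝ] E)
      (E := fun p : M ↦ TangentSpace 𝓘(ℝ, E) p →L[ℝ] TangentSpace 𝓘(ℝ, E) p) p (J p))

namespace AlmostHermitianStructure

variable {E : Type*} [NormedAddCommGroup E] [NormedSpace ℝ E]
  {M : Type*} [TopologicalSpace M] [ChartedSpace E M] [IsManifold 𝓘(ℝ, E) ∞ M]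

/-- `R(x, y, z, u) = R(Jx, Jy, Jz, Ju)` for all tangent vectors. -/
def IsRK (S : AlmostHermitianStructure E M) : Prop :=
  ∀ (p : M) (x y z u : TangentSpace 𝓘(ℝ, E) p),
    curvatureTensor S.g p x y z u =
      curvatureTensor S.g p (S.J p x) (S.J p y) (S.J p z) (S.J p u)

/-- `x`, `y` is an orthonormal basis of a 2-plane `α` with `∠(α, Jα) = θ`, that is
`|g(x, Jy)| = cos θ`. -/
def IsHolomorphicBasis (S : AlmostHermitianStructure E M) (θ : ℝ) (p : M)
    (x y : TangentSpace 𝓘(ℝ, E) p) : Prop :=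
  S.g.inner p x x = 1 ∧ S.g.inner p y y = 1 ∧ S.g.inner p x y = 0 ∧
    |S.g.inner p x (S.J p y)| = Real.cos θ

/-- At each point all `θ`-holomorphic planes have the same sectional curvature `K = R(x, y, y, x)`,
which may depend on the point. -/
def IsPointwiseConstantHolomorphicCurvature (S : AlmostHermitianStructure E M) (θ : ℝ) : Prop :=
  ∀ p : M, ∃ c : ℝ, ∀ x y : TangentSpace 𝓘(ℝ, E) p,
    S.IsHolomorphicBasis θ p x y → curvatureTensor S.g p x y y x = c

/-- All `θ`-holomorphic planes, at all points, have the same sectional curvature. -/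
def IsConstantHolomorphicCurvature (S : AlmostHermitianStructure E M) (θ : ℝ) : Prop :=
  ∃ c : ℝ, ∀ (p : M) (x y : TangentSpace 𝓘(ℝ, E) p),
    S.IsHolomorphicBasis θ p x y → curvatureTensor S.g p x y y x = c

/-- Pointwise constant antiholomorphic sectional curvature: the case `θ = π / 2`. -/
abbrev IsPointwiseConstantAntiholomorphicCurvature (S : AlmostHermitianStructure E M) : Prop :=
  S.IsPointwiseConstantHolomorphicCurvature (Real.pi / 2)

/-- Constant antiholomorphic sectional curvature: the case `θ = π / 2`. -/
abbrev IsConstantAntiholomorphicCurvature (S : AlmostHermitianStructure E M) : Prop :=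
  S.IsConstantHolomorphicCurvature (Real.pi / 2)

end AlmostHermitianStructure

end

/-! Subtract from `R` the curvature tensor of constant sectional curvature `ν`. The difference `T`
(`curvatureExcess`) has the algebraic symmetries of a curvature tensor and vanishes on every
antiholomorphic plane. The goal is `dν = 0`; connectedness then makes `ν` constant.

Pointwise algebra: polarization kills most components of `T`. Among those that survive are `T(x, Jx,
y, x)` with `y` orthogonal to `x`, `Jx`. A third antiholomorphic direction, available in dimension
at least 6, gives `|y|² T(x, Jx, y, x) = -|x|² T(y, Jy, x, y)` (`principal_symm`). Call `x`
principal if all these components vanish. By the RK identity, a maximum of the holomorphic sectional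
curvature on the complement of known principal directions has vanishing components inside that
complement, and `principal_symm` supplies the remaining ones. Hence principal directions span the
tangent space (`span_isPrincipal_eq_top`), and each of them lies in an antiholomorphic triple of
principal directions (`exists_isPrincipalTriple`).

Differential step: for such a triple `w, x, y`, the second Bianchi identity for `R = T + ν(...)`
expresses `dν(w) |x|² |y|²` through derivatives of components of `T` and Christoffel corrections.
The corrections vanish by the algebra. The derivatives vanish because, up to products of two
functions that are zero at the point, these components are identically zero nearby
(`fderiv_curvatureExcess_eq_zero`); no derivative of `J` has to be computed. So `dν` is zero on a
spanning set.

This is carried out in a chart; `curvatureTensor_chartSymmDeriv` provides the independence of the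
chart. -/

/-! ### Curvature-like tensors on a Hermitian vector space -/

section HermitianAlgebra

variable {E : Type*} [NormedAddCommGroup E] [NormedSpace ℝ E]

/-- `g` is an inner product and `J` an orthogonal complex structure for it. -/
structure IsHermitianPair (g : E →L[ℝ] E →L[ℝ] ℝ) (J : E →L[ℝ] E) : Prop where
  symm (x y : E) : g x y = g y x
  pos (x : E) : x ≠ 0 → 0 < g x x
  J_J (x : E) : J (J x) = -x
  g_J_J (x y : E) : g (J x) (J y) = g x y

/-- `T` has the algebraic symmetries of a Riemannian curvature tensor. -/
structure IsCurvatureLike (T : E → E → E → E → ℝ) : Prop where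
  add_left (x x' y z u : E) : T (x + x') y z u = T x y z u + T x' y z u
  smul_left (c : ℝ) (x y z u : E) : T (c • x) y z u = c * T x y z u
  swap_left (x y z u : E) : T x y z u = -T y x z u
  swap_right (x y z u : E) : T x y z u = -T x y u z
  bianchi (x y z u : E) : T x y z u + T y z x u + T z x y u = 0

namespace IsCurvatureLike

variable {T : E → E → E → E → ℝ}

theorem pair (hT : IsCurvatureLike T) (x y z u : E) : T x y z u = T z u x y := by
  have h1 := hT.bianchi x y z u
  have h2 := hT.bianchi y z u x
  have h3 := hT.bianchi z u x y
  have h4 := hT.bianchi u x y z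
  have e1 := hT.swap_right y z u x
  have e2 := hT.swap_right z u y x
  have e3 := hT.swap_right u y z x
  have e4 := hT.swap_left u y x z
  have e5 := hT.swap_right x y z u
  have e6 := hT.swap_left u x z y
  have e7 := hT.swap_right x u z y
  have e8 := hT.swap_left z x y u
  have e9 := hT.swap_right x z y u
  have e10 := hT.swap_right z u x y
  have e11 := hT.swap_right u x z y
  have e12 := hT.swap_left x z u y
  have e13 := hT.swap_left y u x z
  have e14 := hT.swap_right z x y u
  linarith

theorem add₂ (hT : IsCurvatureLike T) (x y y' z u : E) :
    T x (y + y') z u = T x y z u + T x y' z u := by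
  rw [hT.swap_left, hT.add_left, hT.swap_left x y, hT.swap_left x y']; ring

theorem smul₂ (hT : IsCurvatureLike T) (c : ℝ) (x y z u : E) : T x (c • y) z u = c * T x y z u := by
  rw [hT.swap_left, hT.smul_left, hT.swap_left x y]; ring

theorem add₃ (hT : IsCurvatureLike T) (x y z z' u : E) :
    T x y (z + z') u = T x y z u + T x y z' u := by
  rw [hT.pair, hT.add_left, hT.pair z, hT.pair z']

theorem smul₃ (hT : IsCurvatureLike T) (c : ℝ) (x y z u : E) : T x y (c • z) u = c * T x y z u := by
  rw [hT.pair, hT.smul_left, hT.pair z]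

theorem add₄ (hT : IsCurvatureLike T) (x y z u u' : E) :
    T x y z (u + u') = T x y z u + T x y z u' := by
  rw [hT.pair, hT.add₂, hT.pair z, hT.pair z]

theorem smul₄ (hT : IsCurvatureLike T) (c : ℝ) (x y z u : E) : T x y z (c • u) = c * T x y z u := by
  rw [hT.pair, hT.smul₂, hT.pair z]

theorem neg₁ (hT : IsCurvatureLike T) (x y z u : E) : T (-x) y z u = -T x y z u := by
  have := hT.smul_left (-1) x y z u; simpa using this

theorem neg₂ (hT : IsCurvatureLike T) (x y z u : E) : T x (-y) z u = -T x y z u := by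
  have := hT.smul₂ (-1) x y z u; simpa using this

theorem neg₄ (hT : IsCurvatureLike T) (x y z u : E) : T x y z (-u) = -T x y z u := by
  have := hT.smul₄ (-1) x y z u; simpa using this

theorem self_left (hT : IsCurvatureLike T) (x z u : E) :
    T x x z u = 0 := by linarith [hT.swap_left x x z u]

theorem self_right (hT : IsCurvatureLike T) (x y z : E) :
    T x y z z = 0 := by linarith [hT.swap_right x y z z]

end IsCurvatureLike

/-- `x` and `y` span, over the reals, an antiholomorphic plane (if they are nonzero). -/
def AntiOrthogonal (g : E →L[ℝ] E →L[ℝ] ℝ) (J : E →L[ℝ] E) (x y : E) : Prop :=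
  g x y = 0 ∧ g (J x) y = 0

/-- `T` vanishes on all antiholomorphic planes. -/
def VanishesOnAntiholomorphic (g : E →L[ℝ] E →L[ℝ] ℝ) (J : E →L[ℝ] E)
    (T : E → E → E → E → ℝ) : Prop :=
  ∀ x y, AntiOrthogonal g J x y → T x y y x = 0

/-- `a` is a principal direction of `T`: `T(a, Ja, y, a) = 0` for all `y` orthogonal to `a`,
`Ja`. -/
def IsPrincipal (g : E →L[ℝ] E →L[ℝ] ℝ) (J : E →L[ℝ] E) (T : E → E → E → E → ℝ) (a : E) : Prop :=
  ∀ y, AntiOrthogonal g J a y → T a (J a) y a = 0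

variable {g : E →L[ℝ] E →L[ℝ] ℝ} {J : E →L[ℝ] E} {T : E → E → E → E → ℝ}

namespace IsHermitianPair

theorem g_J_left (h : IsHermitianPair g J) (x y : E) : g (J x) y = -g x (J y) := by
  have := h.g_J_J x (J y)
  rw [h.J_J] at this; simpa [neg_eq_iff_eq_neg] using this

theorem g_J_self (h : IsHermitianPair g J) (x : E) : g (J x) x = 0 := by
  have := h.g_J_left x x
  rw [h.symm x] at this; linarith

theorem eq_zero_of_self (h : IsHermitianPair g J) {x : E} (hx : g x x = 0) : x = 0 := by
  by_contra hne
  exact (h.pos x hne).ne' hx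

end IsHermitianPair

namespace AntiOrthogonal

theorem symm (h : IsHermitianPair g J) {x y : E} (hxy : AntiOrthogonal g J x y) :
    AntiOrthogonal g J y x := by
  refine ⟨by rw [h.symm, hxy.1], ?_⟩
  rw [h.g_J_left, h.symm, hxy.2, neg_zero]

theorem J_left (h : IsHermitianPair g J) {x y : E} (hxy : AntiOrthogonal g J x y) :
    AntiOrthogonal g J (J x) y :=
  ⟨hxy.2, by rw [h.J_J]; simp [hxy.1]⟩

theorem J_right (h : IsHermitianPair g J) {x y : E} (hxy : AntiOrthogonal g J x y) :
    AntiOrthogonal g J x (J y) :=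
  ((hxy.symm h).J_left h).symm h

theorem add_right {x y z : E} (hxy : AntiOrthogonal g J x y) (hxz : AntiOrthogonal g J x z) :
    AntiOrthogonal g J x (y + z) :=
  ⟨by rw [map_add, hxy.1, hxz.1, add_zero], by rw [map_add, hxy.2, hxz.2, add_zero]⟩

theorem smul_right {x y : E} (c : ℝ) (hxy : AntiOrthogonal g J x y) :
    AntiOrthogonal g J x (c • y) :=
  ⟨by rw [map_smul, hxy.1, smul_zero], by rw [map_smul, hxy.2, smul_zero]⟩

theorem add_left {x y z : E} (hxz : AntiOrthogonal g J x z) (hyz : AntiOrthogonal g J y z) :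
    AntiOrthogonal g J (x + y) z :=
  ⟨by simp [hxz.1, hyz.1], by simp [hxz.2, hyz.2]⟩

end AntiOrthogonal

/-! ### Components of a curvature-like tensor that vanishes on antiholomorphic planes. -/

namespace VanishesOnAntiholomorphic

/-- No relation between `b` and `c` is needed, so `c = J b` is allowed. -/
theorem polarized (h0 : VanishesOnAntiholomorphic g J T) (hT : IsCurvatureLike T)
    {a b c : E} (hb : AntiOrthogonal g J a b) (hc : AntiOrthogonal g J a c) :
    T a b c a = 0 := by
  have h1 := h0 a (b + c) (hb.add_right hc)
  have h2 := h0 a b hb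
  have h3 := h0 a c hc
  have h4 : T a c b a = T a b c a := by
    rw [hT.pair, hT.swap_left, hT.swap_right]; ring
  simp only [hT.add₂, hT.add₃] at h1
  linarith

/-- Polarization of `polarized` in the outer argument. Since `a` and `d` need not be antiorthogonal,
`d = J a` is allowed. -/
theorem swap_outer (h0 : VanishesOnAntiholomorphic g J T) (hT : IsCurvatureLike T)
    {a b c d : E} (hab : AntiOrthogonal g J a b) (hac : AntiOrthogonal g J a c)
    (hdb : AntiOrthogonal g J d b) (hdc : AntiOrthogonal g J d c) : T a b c d = -T d b c a := by
  have h1 := h0.polarized hT (hab.add_left hdb) (hac.add_left hdc)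
  have h2 := h0.polarized hT hab hac
  have h3 := h0.polarized hT hdb hdc
  simp only [hT.add_left, hT.add₄] at h1
  linarith

/-- By `swap_outer` the three terms of the first Bianchi identity coincide, so each of them is zero.
-/
theorem quadruple (h0 : VanishesOnAntiholomorphic g J T) (h : IsHermitianPair g J)
    (hT : IsCurvatureLike T) {a b c d : E} (hab : AntiOrthogonal g J a b)
    (hac : AntiOrthogonal g J a c)
    (had : AntiOrthogonal g J a d) (hbc : AntiOrthogonal g J b c) (hbd : AntiOrthogonal g J b d)
    (hcd : AntiOrthogonal g J c d) : T a b c d = 0 := by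
  have e1 := h0.swap_outer hT hbc (hab.symm h) (hcd.symm h) (had.symm h)
  have e2 := h0.swap_outer hT (hac.symm h) (hbc.symm h) (had.symm h) (hbd.symm h)
  have e3 := hT.swap_left d c a b
  have e4 := hT.pair c d a b
  have e5 := hT.swap_left d a b c
  have e6 := hT.pair a d b c
  have e7 := hT.bianchi a b c d
  linarith

/-- `swap_outer` with outer pair `x`, `J x` makes two terms of the first Bianchi identity equal,
whence the factor 2. -/
theorem apply_J_of_triple (h0 : VanishesOnAntiholomorphic g J T) (h : IsHermitianPair g J)
    (hT : IsCurvatureLike T) {x y w : E} (hxy : AntiOrthogonal g J x y)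
    (hxw : AntiOrthogonal g J x w) : T y w x (J x) = 2 * T x w y (J x) := by
  have e1 := h0.swap_outer hT hxw hxy (hxw.J_left h) (hxy.J_left h)
  have e2 := hT.pair (J x) w y x
  have e3 := hT.swap_left y x (J x) w
  have e4 := hT.swap_right x y (J x) w
  have e5 := hT.bianchi x y w (J x)
  have e6 := hT.swap_left w x y (J x)
  linarith

theorem three_mul_of_triple (h0 : VanishesOnAntiholomorphic g J T) (h : IsHermitianPair g J)
    (hT : IsCurvatureLike T) {x y w : E} (hxy : AntiOrthogonal g J x y)
    (hxw : AntiOrthogonal g J x w) (hyw : AntiOrthogonal g J y w) :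
    g w w * T x (J x) y x = 3 * (g x x * T w x y (J w)) := by
  have hwx := hxw.symm h
  have hwy := hyw.symm h
  -- Rotating the pair `x`, `w` against `J x`, `J w`: the coefficients are chosen so that the first
  -- two arguments are antiorthogonal exactly because `s² = 1`. Adding `s = 1` and `s = -1` keeps
  -- the terms even in `s`, and `3 = 2 + 1` comes from `e1` and `e2`.
  have key (s : ℝ) (hs : s * s = 1) :
      T (x + s • w) (g w w • J x + (-(s * g x x)) • J w) y (x + s • w) = 0 := by
    refine h0.polarized hT ⟨?_, ?_⟩ ⟨?_, ?_⟩
    · simp [h.symm x (J x), h.symm w (J w), h.g_J_self, h.symm x (J w), h.symm w (J x), hxw.2,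
        hwx.2]
    · simp [h.g_J_J, hxw.1, hwx.1]
      linear_combination (-(g x x * g w w)) * hs
    · simp [hxy.1, hwy.1]
    · simp [hxy.2, hwy.2]
  have k1 := key 1 (by norm_num)
  have k2 := key (-1) (by norm_num)
  simp only [hT.add_left, hT.add₂, hT.add₄, hT.smul_left, hT.smul₂, hT.smul₄] at k1 k2
  have e1 : T w (J w) y x = 2 * T w x y (J w) := by
    rw [hT.pair, h0.apply_J_of_triple h hT hwy hwx]
  have e2 : T x (J w) y w = T w x y (J w) := by
    rw [hT.swap_left, h0.swap_outer hT hwx hwy (hwx.J_left h) (hwy.J_left h)]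
  have e3 : T w (J x) y w = 0 := h0.polarized hT (hwx.J_right h) hwy
  rw [e1, e2, e3] at k1 k2
  linarith

/-- Both sides are multiples of `T(w, x, y, Jw)`, which is skew in `x`, `y` by `swap_outer`; the
auxiliary vector `w` then cancels. -/
theorem principal_symm (h0 : VanishesOnAntiholomorphic g J T) (h : IsHermitianPair g J)
    (hT : IsCurvatureLike T) {x y w : E} (hw : w ≠ 0) (hxy : AntiOrthogonal g J x y)
    (hxw : AntiOrthogonal g J x w) (hyw : AntiOrthogonal g J y w) :
    g y y * T x (J x) y x = -(g x x * T y (J y) x y) := by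
  have e1 := h0.three_mul_of_triple h hT hxy hxw hyw
  have e2 := h0.three_mul_of_triple h hT (hxy.symm h) hyw hxw
  have e3 : T w y x (J w) = -T w x y (J w) := by
    rw [h0.swap_outer hT (hyw.symm h) (hxw.symm h) ((hyw.symm h).J_left h)
      ((hxw.symm h).J_left h), hT.pair, hT.swap_left x w, hT.swap_right w x]
    ring
  rw [e3] at e2
  refine mul_left_cancel₀ (h.pos w hw).ne' ?_
  linear_combination g y y * e1 + g x x * e2

end VanishesOnAntiholomorphic

end HermitianAlgebra

/-! ### Existence of principal directions. -/

section PrincipalDirections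

variable {E : Type*} [NormedAddCommGroup E] [NormedSpace ℝ E]
  {g : E →L[ℝ] E →L[ℝ] ℝ} {J : E →L[ℝ] E} {T : E → E → E → E → ℝ}

namespace IsHermitianPair

variable [FiniteDimensional ℝ E]

/-- Orthogonal projection for `g`, which is unrelated to the norm of `E`: definiteness makes `w ↦
g(w, ·)` injective from `W` to its dual, hence surjective by dimension. -/
theorem exists_mem_sub_orthogonal (h : IsHermitianPair g J) (W : Submodule ℝ E) (y : E) :
    ∃ w ∈ W, ∀ a ∈ W, g a (y - w) = 0 := by
  let f : W →ₗ[ℝ] Module.Dual ℝ W :=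
    { toFun := fun w ↦ ((g w : E →L[ℝ] ℝ) : E →ₗ[ℝ] ℝ).comp W.subtype
      map_add' := fun a b ↦ by ext; simp
      map_smul' := fun c a ↦ by ext; simp }
  have hf : Function.Injective f := by
    rw [injective_iff_map_eq_zero]
    intro w hw
    have := LinearMap.congr_fun hw w
    exact Subtype.ext (h.eq_zero_of_self this)
  have hs : Function.Surjective f :=
    (LinearMap.injective_iff_surjective_of_finrank_eq_finrank
      (Subspace.dual_finrank_eq (K := ℝ) (V := W)).symm).1 hf
  obtain ⟨w, hw⟩ := hs (((g y : E →L[ℝ] ℝ) : E →ₗ[ℝ] ℝ).comp W.subtype)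
  refine ⟨w, w.2, fun a ha ↦ ?_⟩
  have h1 : g w a = g y a := LinearMap.congr_fun hw ⟨a, ha⟩
  rw [map_sub, h.symm, h.symm a, h1, sub_self]

theorem exists_orthogonal_ne_zero (h : IsHermitianPair g J) {W : Submodule ℝ E} (hW : W ≠ ⊤) :
    ∃ x ≠ 0, ∀ a ∈ W, g a x = 0 := by
  obtain ⟨y, hy⟩ := SetLike.exists_not_mem_of_ne_top W hW
  obtain ⟨w, hw, hort⟩ := h.exists_mem_sub_orthogonal W y
  refine ⟨y - w, fun h0 ↦ hy ?_, hort⟩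
  rwa [sub_eq_zero.1 h0]

/-- An additive function vanishes if it does so on a subspace and on its orthogonal complement. -/
theorem eq_zero_of_span (h : IsHermitianPair g J) (s : Set E) (f : E → ℝ)
    (hadd : ∀ x y, f (x + y) = f x + f y) (hsmul : ∀ (c : ℝ) x, f (c • x) = c * f x)
    (hs : ∀ a ∈ s, f a = 0) (hort : ∀ x, (∀ a ∈ s, g a x = 0) → f x = 0) (x : E) : f x = 0 := by
  obtain ⟨w, hw, hxw⟩ := h.exists_mem_sub_orthogonal (Submodule.span ℝ s) x
  have h1 : f w = 0 := by
    clear hxw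
    induction hw using Submodule.span_induction with
    | mem a ha => exact hs a ha
    | zero => simpa using hsmul 0 0
    | add a b _ _ ha hb => rw [hadd, ha, hb, add_zero]
    | smul c a _ ha => rw [hsmul, ha, mul_zero]
  have h2 := hort (x - w) fun a ha ↦ hxw a (Submodule.subset_span ha)
  have h3 := hadd w (x - w)
  rw [add_sub_cancel, h1, h2, add_zero] at h3
  exact h3

end IsHermitianPair

theorem Submodule.span_finset_ne_top [FiniteDimensional ℝ E] (s : Finset E)
    (hs : s.card < Module.finrank ℝ E) : Submodule.span ℝ (s : Set E) ≠ ⊤ := by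
  intro htop
  have := finrank_span_finset_le_card (R := ℝ) s
  rw [Set.finrank, htop, finrank_top] at this
  omega

/-- The polynomial vanishes at 0, which is therefore a maximum; `c₁` is the derivative there. -/
theorem coeff_eq_zero_of_quartic_nonpos {c₁ c₂ c₃ c₄ : ℝ}
    (hc : ∀ t : ℝ, c₁ * t + c₂ * t ^ 2 + c₃ * t ^ 3 + c₄ * t ^ 4 ≤ 0) : c₁ = 0 := by
  have hd : HasDerivAt (fun t : ℝ ↦ c₁ * t + c₂ * t ^ 2 + c₃ * t ^ 3 + c₄ * t ^ 4) c₁ 0 := by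
    have := ((((hasDerivAt_id (0 : ℝ)).const_mul c₁).add
      (((hasDerivAt_id (0 : ℝ)).pow 2).const_mul c₂)).add
      (((hasDerivAt_id (0 : ℝ)).pow 3).const_mul c₃)).add
      (((hasDerivAt_id (0 : ℝ)).pow 4).const_mul c₄)
    exact this.congr_deriv (by simp)
  refine IsLocalMax.hasDerivAt_eq_zero (Filter.Eventually.of_forall fun t ↦ ?_) hd
  simpa using hc t

namespace VanishesOnAntiholomorphic

variable [FiniteDimensional ℝ E]

theorem principal_symm_of_finrank (h0 : VanishesOnAntiholomorphic g J T)
    (h : IsHermitianPair g J) (hT : IsCurvatureLike T) (hdim : 6 ≤ Module.finrank ℝ E)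
    {x y : E} (hxy : AntiOrthogonal g J x y) :
    g y y * T x (J x) y x = -(g x x * T y (J y) x y) := by
  classical
  obtain ⟨w, hw0, hw⟩ := h.exists_orthogonal_ne_zero
    (Submodule.span_finset_ne_top ({x, J x, y, J y} : Finset E)
      (by have := Finset.card_le_four (a := x) (b := J x) (c := y) (d := J y); omega))
  have hw' (a : E) (ha : a ∈ ({x, J x, y, J y} : Finset E)) : g a w = 0 :=
    hw a (Submodule.subset_span ha)
  exact h0.principal_symm h hT hw0 hxy ⟨hw' _ (by simp), hw' _ (by simp)⟩
    ⟨hw' _ (by simp), hw' _ (by simp)⟩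

end VanishesOnAntiholomorphic

/-- The RK identity enters here: it turns the condition for `J a` into the condition for `a` at `J
y`. -/
theorem IsPrincipal.map_J (h : IsHermitianPair g J) (hT : IsCurvatureLike T)
    (hRK : ∀ x y z u, T x y z u = T (J x) (J y) (J z) (J u)) {a : E} (ha : IsPrincipal g J T a) :
    IsPrincipal g J T (J a) := by
  intro y hy
  have hay : AntiOrthogonal g J a y := by
    have := (hy.J_left h)
    rw [h.J_J] at this
    exact ⟨by simpa using this.1, by simpa using this.2⟩
  have := ha _ (hay.J_right h)
  rw [hRK]
  simp only [h.J_J, hT.neg₁, hT.neg₂, hT.neg₄, map_neg]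
  rw [this]; simp

/-- A maximum of the holomorphic sectional curvature on the orthogonal complement of a `J`-stable
space spanned by principal directions is a principal direction. -/
theorem exists_isPrincipal_orthogonal [FiniteDimensional ℝ E] (h : IsHermitianPair g J)
    (hT : IsCurvatureLike T) (h0 : VanishesOnAntiholomorphic g J T)
    (hRK : ∀ x y z u, T x y z u = T (J x) (J y) (J z) (J u))
    (hcont : Continuous fun x ↦ T x (J x) (J x) x) (hdim : 6 ≤ Module.finrank ℝ E)
    (s : Set E) (hs : ∀ a ∈ s, IsPrincipal g J T a) (hJs : ∀ a ∈ s, J a ∈ s)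
    (htop : Submodule.span ℝ s ≠ ⊤) :
    ∃ x ≠ 0, IsPrincipal g J T x ∧ ∀ a ∈ s, AntiOrthogonal g J a x := by
  obtain ⟨v, hv0, hv⟩ := h.exists_orthogonal_ne_zero htop
  let N : Set E := {x | ∀ a ∈ s, g a x = 0}
  have hNadd {x y : E} (hx : x ∈ N) (hy : y ∈ N) : x + y ∈ N := fun a ha ↦ by
    rw [map_add, hx a ha, hy a ha, add_zero]
  have hNsmul (c : ℝ) {x : E} (hx : x ∈ N) : c • x ∈ N := fun a ha ↦ by
    rw [map_smul, hx a ha, smul_zero]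
  have hNJ {x : E} (hx : x ∈ N) : J x ∈ N := fun a ha ↦ by
    rw [← neg_eq_zero, ← h.g_J_left]; exact hx _ (hJs a ha)
  have hNclosed : IsClosed N := by
    have : N = ⋂ a ∈ s, {x | g a x = 0} := by ext; simp [N]
    rw [this]
    exact isClosed_biInter fun a _ ↦ isClosed_eq (g a).continuous continuous_const
  let H : E → ℝ := fun x ↦ T x (J x) (J x) x
  have hHsmul (c : ℝ) (x : E) : H (c • x) = c ^ 4 * H x := by
    simp only [H, map_smul, hT.smul_left, hT.smul₂, hT.smul₃, hT.smul₄]; ring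
  have hgcont : Continuous fun x ↦ g x x := by fun_prop
  have hK : IsCompact (Metric.sphere (0 : E) 1 ∩ N) := (isCompact_sphere _ _).inter_right hNclosed
  have hKne : (Metric.sphere (0 : E) 1 ∩ N).Nonempty := by
    refine ⟨‖v‖⁻¹ • v, ?_, hNsmul _ fun a ha ↦ hv a (Submodule.subset_span ha)⟩
    simp [norm_smul, hv0]
  have hne {x : E} (hx : x ∈ Metric.sphere (0 : E) 1 ∩ N) : x ≠ 0 := by
    rintro rfl
    simpa using hx.1
  -- The quotient is homogeneous of degree 0, so its maximum on the compact unit sphere of `N` is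
  -- its maximum on all nonzero vectors of `N`.
  obtain ⟨x, hxK, hmax⟩ := hK.exists_isMaxOn hKne (f := fun x ↦ H x / g x x ^ 2)
    (hcont.continuousOn.div (hgcont.pow 2).continuousOn
      fun x hx ↦ pow_ne_zero _ (h.pos x (hne hx)).ne')
  have hx0 := hne hxK
  have hxN : x ∈ N := hxK.2
  have hgx := h.pos x hx0
  have hle (z : E) (hz : z ∈ N) (hz0 : z ≠ 0) : H z * g x x ^ 2 ≤ H x * g z z ^ 2 := by
    have hz1 : 0 < ‖z‖ := norm_pos_iff.2 hz0
    have hm := hmax (show ‖z‖⁻¹ • z ∈ Metric.sphere (0 : E) 1 ∩ N from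
      ⟨by simp [norm_smul, hz0], hNsmul _ hz⟩)
    simp only [Set.mem_ofPred_eq, hHsmul, map_smul, _root_.smul_apply, smul_eq_mul]
      at hm
    have hgz := h.pos z hz0
    have e : ‖z‖⁻¹ ^ 4 * H z / (‖z‖⁻¹ * (‖z‖⁻¹ * g z z)) ^ 2 = H z / g z z ^ 2 := by
      field_simp
    rw [e, div_le_div_iff₀ (by positivity) (by positivity)] at hm
    exact hm
  -- First variation at the maximum: by RK and the pair symmetry (`e1`, `e2`, `e3`) all four terms
  -- linear in `t` equal `T(x, Jy, Jx, x)`.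
  have hcrit (y : E) (hy : y ∈ N) (hxy : g x y = 0) : T x (J y) (J x) x = 0 := by
    have hyx : g y x = 0 := by rw [h.symm, hxy]
    have hpoly (t : ℝ) : H (x + t • y) * g x x ^ 2 ≤ H x * (g x x + t ^ 2 * g y y) ^ 2 := by
      have hz0 : x + t • y ≠ 0 := by
        intro hz
        have : g x (x + t • y) = 0 := by rw [hz, map_zero]
        rw [map_add, map_smul, hxy, smul_zero, add_zero] at this
        exact hgx.ne' this
      have := hle _ (hNadd hxN (hNsmul t hy)) hz0
      have e : g (x + t • y) (x + t • y) = g x x + t ^ 2 * g y y := by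
        simp [hxy, hyx]; ring
      rwa [e] at this
    simp only [H, map_add, map_smul, hT.add_left, hT.add₂, hT.add₃, hT.add₄, hT.smul_left,
      hT.smul₂, hT.smul₃, hT.smul₄] at hpoly
    have e1 : T y (J x) (J x) x = T x (J y) (J x) x := by
      rw [hRK, hT.swap_left, hT.swap_right]
      simp only [h.J_J, hT.neg₁, hT.neg₄, neg_neg]
    have e2 : T x (J x) (J y) x = T x (J y) (J x) x := by
      rw [hT.pair, hT.swap_left, hT.swap_right, neg_neg]
    have e3 : T x (J x) (J x) y = T x (J y) (J x) x := by
      rw [hT.pair, hT.swap_left, hT.swap_right, neg_neg, e1]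
    have := coeff_eq_zero_of_quartic_nonpos (c₁ := 4 * T x (J y) (J x) x * g x x ^ 2)
      (c₂ := (T y (J y) (J x) x + T y (J x) (J y) x + T y (J x) (J x) y + T x (J y) (J y) x
        + T x (J y) (J x) y + T x (J x) (J y) y) * g x x ^ 2
        - 2 * T x (J x) (J x) x * g x x * g y y)
      (c₃ := (T y (J y) (J y) x + T y (J y) (J x) y + T y (J x) (J y) y + T x (J y) (J y) y)
        * g x x ^ 2)
      (c₄ := T y (J y) (J y) y * g x x ^ 2 - T x (J x) (J x) x * g y y ^ 2)
      (fun t ↦ by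
        have := hpoly t
        rw [e1, e2, e3] at this
        linarith)
    simpa [hgx.ne'] using this
  have hsx (a : E) (ha : a ∈ s) : AntiOrthogonal g J a x := ⟨hxN a ha, hxN _ (hJs a ha)⟩
  refine ⟨x, hx0, fun y hy ↦ ?_, hsx⟩
  -- Split `y` into a part `w` in the span of `s` and a part in `N`. The first is handled by
  -- `principal_symm_of_finrank`, as the elements of `s` are principal, the second by `hcrit`.
  obtain ⟨w, hw, hyw⟩ := h.exists_mem_sub_orthogonal (Submodule.span ℝ s) y
  have hzN : y - w ∈ N := fun a ha ↦ hyw a (Submodule.subset_span ha)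
  have hwx : g w x = 0 ∧ g (J w) x = 0 ∧ T x (J x) w x = 0 := by
    clear hyw hzN
    induction hw using Submodule.span_induction with
    | mem a ha =>
      refine ⟨(hsx a ha).1, (hsx a ha).2, ?_⟩
      rcases eq_or_ne a 0 with rfl | ha0
      · simpa using hT.smul₃ 0 x (J x) 0 x
      have := h0.principal_symm_of_finrank h hT hdim ((hsx a ha).symm h)
      rw [hs a ha x (hsx a ha), mul_zero, neg_zero] at this
      exact (mul_eq_zero.1 this).resolve_left (h.pos a ha0).ne'
    | zero => simpa using hT.smul₃ 0 x (J x) 0 x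
    | add a b _ _ ha hb => simp [hT.add₃, ha, hb]
    | smul c a _ ha => simp [hT.smul₃, ha]
  have hxz : AntiOrthogonal g J x (y - w) := by
    have := hy.add_right ((show AntiOrthogonal g J x w from
      AntiOrthogonal.symm h ⟨hwx.1, hwx.2.1⟩).smul_right (-1))
    simpa [sub_eq_add_neg] using this
  have hz : T x (y - w) (J x) x = 0 := by
    -- Apply `hcrit` to `-J(y - w)`, whose image under `J` is `y - w`.
    have := hcrit _ (hNJ (hNsmul (-1) hzN)) (by
      rw [← neg_eq_zero, ← h.g_J_left, map_smul, hxz.2, smul_zero])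
    rwa [h.J_J, neg_smul, one_smul, neg_neg] at this
  have e : T x (J x) (y - w) x = T x (y - w) (J x) x := by
    rw [hT.pair, hT.swap_left, hT.swap_right, neg_neg]
  rw [← sub_add_cancel y w, hT.add₃, e, hz, hwx.2.2, add_zero]

/-- Otherwise a new principal direction would be orthogonal to all principal ones, itself included.
-/
theorem span_isPrincipal_eq_top [FiniteDimensional ℝ E] (h : IsHermitianPair g J)
    (hT : IsCurvatureLike T) (h0 : VanishesOnAntiholomorphic g J T)
    (hRK : ∀ x y z u, T x y z u = T (J x) (J y) (J z) (J u))
    (hcont : Continuous fun x ↦ T x (J x) (J x) x) (hdim : 6 ≤ Module.finrank ℝ E) :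
    Submodule.span ℝ {a | IsPrincipal g J T a} = ⊤ := by
  by_contra htop
  obtain ⟨x, hx0, hx, hort⟩ := exists_isPrincipal_orthogonal h hT h0 hRK hcont hdim _
    (fun a ha ↦ ha) (fun a ha ↦ IsPrincipal.map_J h hT hRK ha) htop
  exact hx0 (h.eq_zero_of_self (hort x hx).1)

/-- Three principal directions spanning an antiholomorphic space. -/
structure IsPrincipalTriple (g : E →L[ℝ] E →L[ℝ] ℝ) (J : E →L[ℝ] E) (T : E → E → E → E → ℝ)
    (w x y : E) : Prop where
  principal_w : IsPrincipal g J T w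
  principal_x : IsPrincipal g J T x
  principal_y : IsPrincipal g J T y
  wx : AntiOrthogonal g J w x
  wy : AntiOrthogonal g J w y
  xy : AntiOrthogonal g J x y

theorem exists_isPrincipalTriple [FiniteDimensional ℝ E] (h : IsHermitianPair g J)
    (hT : IsCurvatureLike T) (h0 : VanishesOnAntiholomorphic g J T)
    (hRK : ∀ x y z u, T x y z u = T (J x) (J y) (J z) (J u))
    (hcont : Continuous fun x ↦ T x (J x) (J x) x) (hdim : 6 ≤ Module.finrank ℝ E)
    {w : E} (hw : IsPrincipal g J T w) :
    ∃ x y, x ≠ 0 ∧ y ≠ 0 ∧ IsPrincipalTriple g J T w x y := by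
  classical
  have hneg {a : E} (ha : IsPrincipal g J T a) : IsPrincipal g J T (-a) := by
    have := IsPrincipal.map_J h hT hRK (IsPrincipal.map_J h hT hRK ha)
    rwa [h.J_J] at this
  have hJ {a : E} (ha : IsPrincipal g J T a) := IsPrincipal.map_J h hT hRK ha
  -- The negatives make the set stable under `J` without enlarging the span, which has dimension at
  -- most 2 here and at most 4 in the next choice.
  obtain ⟨x, hx0, hx, hwx⟩ := exists_isPrincipal_orthogonal h hT h0 hRK hcont hdim
    {w, J w, -w, -J w} (by simp [hw, hJ hw, hneg hw, hneg (hJ hw)]) (by simp [h.J_J]) (by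
      have := Submodule.span_finset_ne_top ({w, J w} : Finset E)
        (by have := Finset.card_le_two (a := w) (b := J w); omega)
      intro htop
      refine this (top_unique ?_)
      rw [← htop, Submodule.span_le]
      have e1 : w ∈ Submodule.span ℝ (({w, J w} : Finset E) : Set E) :=
        Submodule.subset_span (by simp)
      have e2 : J w ∈ Submodule.span ℝ (({w, J w} : Finset E) : Set E) :=
        Submodule.subset_span (by simp)
      rintro a (rfl | rfl | rfl | rfl)
      exacts [e1, e2, neg_mem e1, neg_mem e2])
  obtain ⟨y, hy0, hy, hwy⟩ := exists_isPrincipal_orthogonal h hT h0 hRK hcont hdim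
    {w, J w, -w, -J w, x, J x, -x, -J x}
    (by simp [hw, hJ hw, hneg hw, hneg (hJ hw), hx, hJ hx, hneg hx, hneg (hJ hx)])
    (by simp [h.J_J]) (by
      have := Submodule.span_finset_ne_top ({w, J w, x, J x} : Finset E)
        (by have := Finset.card_le_four (a := w) (b := J w) (c := x) (d := J x); omega)
      intro htop
      refine this (top_unique ?_)
      rw [← htop, Submodule.span_le]
      have e1 : w ∈ Submodule.span ℝ (({w, J w, x, J x} : Finset E) : Set E) :=
        Submodule.subset_span (by simp)
      have e2 : J w ∈ Submodule.span ℝ (({w, J w, x, J x} : Finset E) : Set E) :=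
        Submodule.subset_span (by simp)
      have e3 : x ∈ Submodule.span ℝ (({w, J w, x, J x} : Finset E) : Set E) :=
        Submodule.subset_span (by simp)
      have e4 : J x ∈ Submodule.span ℝ (({w, J w, x, J x} : Finset E) : Set E) :=
        Submodule.subset_span (by simp)
      rintro a (rfl | rfl | rfl | rfl | rfl | rfl | rfl | rfl)
      exacts [e1, e2, neg_mem e1, neg_mem e2, e3, e4, neg_mem e3, neg_mem e4])
  exact ⟨x, y, hx0, hy0, hw, hx, hy, hwx w (by simp), hwy w (by simp), hwy x (by simp)⟩

/-- Decompose `v` along `a`, `J a` and their complement: skew-symmetry, principality and `polarized`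
treat one part each. -/
theorem IsPrincipal.apply_eq_zero [FiniteDimensional ℝ E] (h : IsHermitianPair g J)
    (hT : IsCurvatureLike T) (h0 : VanishesOnAntiholomorphic g J T) {a b : E}
    (ha : IsPrincipal g J T a) (hab : AntiOrthogonal g J a b) (v : E) : T a b v a = 0 := by
  refine h.eq_zero_of_span {a, J a} (fun v ↦ T a b v a) (fun _ _ ↦ hT.add₃ _ _ _ _ _)
    (fun _ _ ↦ hT.smul₃ _ _ _ _ _) ?_ (fun v hv ↦ ?_) v
  · rintro _ (rfl | rfl)
    · exact hT.self_right _ _ _ |>.symm ▸ rfl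
    · have := ha b hab
      rwa [hT.pair, hT.swap_left, hT.swap_right, neg_neg] at this
  · exact h0.polarized hT hab ⟨hv a (by simp), hv (J a) (by simp)⟩

/-- For `v` orthogonal to the triple and its `J`-image this is `quadruple`. In the `J`-directions,
`three_mul_of_triple` reduces it to principality. With `v` arbitrary, it removes Christoffel
corrections from the Bianchi identity. -/
theorem IsPrincipalTriple.apply_eq_zero [FiniteDimensional ℝ E] (h : IsHermitianPair g J)
    (hT : IsCurvatureLike T) (h0 : VanishesOnAntiholomorphic g J T) {a b c : E}
    (ha0 : a ≠ 0) (hb0 : b ≠ 0) (hc0 : c ≠ 0)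
    (ht : IsPrincipalTriple g J T a b c) (v : E) : T a b c v = 0 := by
  obtain ⟨ha, hb, hc, hab, hac, hbc⟩ := ht
  have hJ {w x y : E} (hw : w ≠ 0) (hx : x ≠ 0) (hwx : AntiOrthogonal g J w x)
      (hwy : AntiOrthogonal g J w y) (hxy : AntiOrthogonal g J x y) (hxp : IsPrincipal g J T x) :
      T w x y (J w) = 0 := by
    have := h0.three_mul_of_triple h hT hxy (hwx.symm h) (hwy.symm h)
    rw [hxp y hxy, mul_zero] at this
    simpa [(h.pos x hx).ne'] using this
  refine h.eq_zero_of_span {a, J a, b, J b, c, J c} (fun v ↦ T a b c v)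
    (fun _ _ ↦ hT.add₄ _ _ _ _ _) (fun _ _ ↦ hT.smul₄ _ _ _ _ _) ?_ (fun v hv ↦ ?_) v
  · rintro _ (rfl | rfl | rfl | rfl | rfl | rfl)
    · exact h0.polarized hT hab hac
    · exact hJ ha0 hb0 hab hac hbc hb
    · rw [hT.swap_left, h0.polarized hT (hab.symm h) hbc, neg_zero]
    · rw [hT.swap_left, hJ hb0 ha0 (hab.symm h) hbc hac ha, neg_zero]
    · exact hT.self_right _ _ _
    · rw [h0.apply_J_of_triple h hT (hac.symm h) (hbc.symm h),
        hJ hc0 hb0 (hbc.symm h) (hac.symm h) (hab.symm h) hb, mul_zero]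
  · exact h0.quadruple h hT hab hac ⟨hv a (by simp), hv (J a) (by simp)⟩ hbc
      ⟨hv b (by simp), hv (J b) (by simp)⟩ ⟨hv c (by simp), hv (J c) (by simp)⟩

end PrincipalDirections

/-! ### The Levi-Civita connection of a metric in coordinates -/

section LeviCivita

set_option maxSynthPendingDepth 3

variable {E : Type*} [NormedAddCommGroup E] [NormedSpace ℝ E]

/-- The Christoffel map as a field of continuous bilinear maps. -/
noncomputable def christoffelCLM (G : E → E →L[ℝ] E →L[ℝ] ℝ) (q : E) : E →L[ℝ] E →L[ℝ] E :=
  (ContinuousLinearMap.compL ℝ E (E →L[ℝ] ℝ) E (G q).inverse).comp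
    ((1 / 2 : ℝ) • (fderiv ℝ G q + (fderiv ℝ G q).flip
      - ((ContinuousLinearMap.flipₗᵢ ℝ E E ℝ).toContinuousLinearEquiv :
        (E →L[ℝ] E →L[ℝ] ℝ) →L[ℝ] (E →L[ℝ] E →L[ℝ] ℝ)).comp (fderiv ℝ G q).flip))

theorem christoffelCLM_apply (G : E → E →L[ℝ] E →L[ℝ] ℝ) (q x y : E) :
    christoffelCLM G q x y = christoffel G q x y := rfl

/-- `G` is a smooth field of inner products on the open set `U`. -/
structure IsMetricOn (G : E → E →L[ℝ] E →L[ℝ] ℝ) (U : Set E) : Prop where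
  isOpen : IsOpen U
  contDiffOn : ContDiffOn ℝ ∞ G U
  symm : ∀ q ∈ U, ∀ x y, G q x y = G q y x
  pos : ∀ q ∈ U, ∀ x, x ≠ 0 → 0 < G q x x

theorem HasFDerivAt.clm_apply_const {F F' : Type*} [NormedAddCommGroup F] [NormedSpace ℝ F]
    [NormedAddCommGroup F'] [NormedSpace ℝ F'] {A : E → F →L[ℝ] F'} {A' : E →L[ℝ] F →L[ℝ] F'}
    {q : E} (hA : HasFDerivAt A A' q) (x : F) :
    HasFDerivAt (fun r ↦ A r x) (A'.flip x) q :=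
  (hA.clm_apply (hasFDerivAt_const x q)).congr_fderiv (by ext; simp)

theorem two_le_smooth : minSmoothness ℝ 2 ≤ (∞ : WithTop ℕ∞) := by
  rw [minSmoothness_of_isRCLikeNormedField]
  exact WithTop.coe_le_coe.2 le_top

namespace IsMetricOn

variable {G : E → E →L[ℝ] E →L[ℝ] ℝ} {U : Set E} {q : E}

theorem contDiffAt (hG : IsMetricOn G U) (hq : q ∈ U) : ContDiffAt ℝ ∞ G q :=
  hG.contDiffOn.contDiffAt (hG.isOpen.mem_nhds hq)

theorem hasFDerivAt (hG : IsMetricOn G U) (hq : q ∈ U) : HasFDerivAt G (fderiv ℝ G q) q :=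
  ((hG.contDiffAt hq).differentiableAt (by simp)).hasFDerivAt

theorem contDiffAt_fderiv (hG : IsMetricOn G U) (hq : q ∈ U) : ContDiffAt ℝ ∞ (fderiv ℝ G) q :=
  (hG.contDiffAt hq).fderiv_right (by simp)

theorem fderiv_symm (hG : IsMetricOn G U) (hq : q ∈ U) (v x y : E) :
    fderiv ℝ G q v x y = fderiv ℝ G q v y x := by
  have h1 := ((hG.hasFDerivAt hq).clm_apply_const x).clm_apply_const y
  have h2 := ((hG.hasFDerivAt hq).clm_apply_const y).clm_apply_const x
  have h3 : (fun r ↦ G r x y) =ᶠ[nhds q] fun r ↦ G r y x := by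
    filter_upwards [hG.isOpen.mem_nhds hq] with r hr using hG.symm r hr x y
  exact congrArg (fun L : E →L[ℝ] ℝ ↦ L v) (h1.unique (h2.congr_of_eventuallyEq h3))

theorem ext (hG : IsMetricOn G U) (hq : q ∈ U) {x y : E} (h : ∀ w, G q x w = G q y w) :
    x = y := by
  by_contra hne
  have := hG.pos q hq (x - y) (sub_ne_zero.2 hne)
  have h' : G q (x - y) = 0 := by ext w; simp [h]
  rw [h'] at this
  exact this.false

variable [FiniteDimensional ℝ E]

theorem exists_equiv (hG : IsMetricOn G U) (hq : q ∈ U) :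
    ∃ e : E ≃L[ℝ] (E →L[ℝ] ℝ), (e : E →L[ℝ] E →L[ℝ] ℝ) = G q := by
  have hinj : Function.Injective (G q : E →ₗ[ℝ] E →L[ℝ] ℝ) := fun x y hxy ↦
    hG.ext hq fun w ↦ congrArg (fun L : E →L[ℝ] ℝ ↦ L w) hxy
  have hfin : Module.finrank ℝ E = Module.finrank ℝ (E →L[ℝ] ℝ) := by
    rw [← (LinearMap.toContinuousLinearMap (𝕜 := ℝ) (E := E) (F' := ℝ)).finrank_eq]
    exact (Subspace.dual_finrank_eq (K := ℝ) (V := E)).symm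
  exact ⟨(LinearEquiv.ofInjectiveOfFinrankEq _ hinj hfin).toContinuousLinearEquiv, by ext; rfl⟩

theorem apply_inverse (hG : IsMetricOn G U) (hq : q ∈ U) (f : E →L[ℝ] ℝ) :
    G q ((G q).inverse f) = f := by
  obtain ⟨e, he⟩ := hG.exists_equiv hq
  rw [← he, ContinuousLinearMap.inverse_equiv]
  simp

theorem koszul (hG : IsMetricOn G U) (hq : q ∈ U) (x y w : E) :
    G q (christoffelCLM G q x y) w =
      (fderiv ℝ G q x y w + fderiv ℝ G q y x w - fderiv ℝ G q w x y) / 2 := by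
  rw [christoffelCLM_apply, christoffel, hG.apply_inverse hq]
  simp; ring

theorem christoffelCLM_symm (hG : IsMetricOn G U) (hq : q ∈ U) (x y : E) :
    christoffelCLM G q x y = christoffelCLM G q y x :=
  hG.ext hq fun w ↦ by
    rw [hG.koszul hq, hG.koszul hq, hG.fderiv_symm hq w x y]; ring

/-- Metric compatibility `∇G = 0`, from the Koszul formula. -/
theorem fderiv_eq (hG : IsMetricOn G U) (hq : q ∈ U) (w a b : E) :
    fderiv ℝ G q w a b =
      G q (christoffelCLM G q w a) b + G q a (christoffelCLM G q w b) := by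
  rw [hG.symm q hq a, hG.koszul hq, hG.koszul hq, hG.fderiv_symm hq w a b,
    hG.fderiv_symm hq a w b, hG.fderiv_symm hq b w a]
  ring

theorem contDiffAt_christoffelCLM (hG : IsMetricOn G U) (hq : q ∈ U) :
    ContDiffAt ℝ ∞ (christoffelCLM G) q := by
  have := FiniteDimensional.complete ℝ E
  have hinv : ContDiffAt ℝ ∞ (fun r ↦ (G r).inverse) q := by
    obtain ⟨e, he⟩ := hG.exists_equiv hq
    have := contDiffAt_map_inverse (𝕜 := ℝ) (n := ∞) e
    rw [he] at this
    exact this.comp q (hG.contDiffAt hq)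
  have hD := hG.contDiffAt_fderiv hq
  have hflip : ContDiffAt ℝ ∞ (fun r ↦ (fderiv ℝ G r).flip) q :=
    (ContinuousLinearMap.flipₗᵢ ℝ E E (E →L[ℝ] ℝ)).toContinuousLinearEquiv.contDiff.contDiffAt.comp
      q hD
  exact ((ContinuousLinearMap.compL ℝ E (E →L[ℝ] ℝ) E).contDiff.contDiffAt.comp q hinv).clm_comp
    (((hD.add hflip).sub (contDiffAt_const.clm_comp hflip)).const_smul (1 / 2 : ℝ))

theorem hasFDerivAt_christoffelCLM (hG : IsMetricOn G U) (hq : q ∈ U) :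
    HasFDerivAt (christoffelCLM G) (fderiv ℝ (christoffelCLM G) q) q :=
  ((hG.contDiffAt_christoffelCLM hq).differentiableAt (by simp)).hasFDerivAt

theorem hasFDerivAt_fderiv_christoffelCLM (hG : IsMetricOn G U) (hq : q ∈ U) :
    HasFDerivAt (fderiv ℝ (christoffelCLM G)) (fderiv ℝ (fderiv ℝ (christoffelCLM G)) q) q :=
  (((hG.contDiffAt_christoffelCLM hq).fderiv_right (m := ∞) (by simp)).differentiableAt
    (by simp)).hasFDerivAt

theorem coordCurvature_eq (hG : IsMetricOn G U) (hq : q ∈ U) (x y z : E) :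
    coordCurvature G q x y z =
      fderiv ℝ (christoffelCLM G) q x y z - fderiv ℝ (christoffelCLM G) q y x z
        + christoffelCLM G q x (christoffelCLM G q y z)
        - christoffelCLM G q y (christoffelCLM G q x z) := by
  have h (a b : E) : fderiv ℝ (fun r ↦ christoffel G r a b) q =
      ((fderiv ℝ (christoffelCLM G) q).flip a).flip b :=
    (((hG.hasFDerivAt_christoffelCLM hq).clm_apply_const a).clm_apply_const b).fderiv
  simp only [coordCurvature, h, christoffelCLM_apply, ContinuousLinearMap.flip_apply]

theorem fderiv_christoffelCLM_symm (hG : IsMetricOn G U) (hq : q ∈ U) (v x y : E) :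
    fderiv ℝ (christoffelCLM G) q v x y = fderiv ℝ (christoffelCLM G) q v y x := by
  have h1 := ((hG.hasFDerivAt_christoffelCLM hq).clm_apply_const x).clm_apply_const y
  have h2 := ((hG.hasFDerivAt_christoffelCLM hq).clm_apply_const y).clm_apply_const x
  have h3 : (fun r ↦ christoffelCLM G r x y) =ᶠ[nhds q] fun r ↦ christoffelCLM G r y x := by
    filter_upwards [hG.isOpen.mem_nhds hq] with r hr using hG.christoffelCLM_symm hr x y
  exact congrArg (fun L : E →L[ℝ] E ↦ L v) (h1.unique (h2.congr_of_eventuallyEq h3))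

theorem coordCurvature_swap_left (hG : IsMetricOn G U) (hq : q ∈ U) (x y z : E) :
    coordCurvature G q x y z = -coordCurvature G q y x z := by
  rw [hG.coordCurvature_eq hq, hG.coordCurvature_eq hq]; abel

theorem coordCurvature_bianchi (hG : IsMetricOn G U) (hq : q ∈ U) (x y z : E) :
    coordCurvature G q x y z + coordCurvature G q y z x + coordCurvature G q z x y = 0 := by
  simp only [hG.coordCurvature_eq hq]
  rw [hG.fderiv_christoffelCLM_symm hq x z y, hG.fderiv_christoffelCLM_symm hq y z x,
    hG.fderiv_christoffelCLM_symm hq z y x, hG.christoffelCLM_symm hq z x,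
    hG.christoffelCLM_symm hq z y, hG.christoffelCLM_symm hq y x]
  abel

/-- Differentiate `∇G = 0` once more and antisymmetrize: second derivatives of `G` commute, so the
curvature operator is skew for `G`. -/
theorem coordCurvature_swap_right (hG : IsMetricOn G U) (hq : q ∈ U) (x y z u : E) :
    G q (coordCurvature G q x y z) u = -G q (coordCurvature G q x y u) z := by
  have hC := hG.hasFDerivAt_christoffelCLM hq
  have hDG : HasFDerivAt (fderiv ℝ G) (fderiv ℝ (fderiv ℝ G) q) q :=
    ((hG.contDiffAt_fderiv hq).differentiableAt (by simp)).hasFDerivAt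
  have hsymm := (hG.contDiffAt hq).isSymmSndFDerivAt two_le_smooth
  have key (x y : E) : fderiv ℝ (fderiv ℝ G) q x y z u =
      fderiv ℝ G q x (christoffelCLM G q y z) u + G q (fderiv ℝ (christoffelCLM G) q x y z) u
      + (fderiv ℝ G q x z (christoffelCLM G q y u)
        + G q z (fderiv ℝ (christoffelCLM G) q x y u)) := by
    have h1 := ((hDG.clm_apply_const y).clm_apply_const z).clm_apply_const u
    have h2 := (((hG.hasFDerivAt hq).clm_apply
      ((hC.clm_apply_const y).clm_apply_const z)).clm_apply_const u).add
      (((hG.hasFDerivAt hq).clm_apply_const z).clm_apply ((hC.clm_apply_const y).clm_apply_const u))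
    have h3 : (fun r ↦ fderiv ℝ G r y z u) =ᶠ[nhds q]
        ((fun r ↦ G r (christoffelCLM G r y z) u) + fun r ↦ G r z (christoffelCLM G r y u)) := by
      filter_upwards [hG.isOpen.mem_nhds hq] with r hr using hG.fderiv_eq hr y z u
    have := congrArg (fun L : E →L[ℝ] ℝ ↦ L x) (h1.unique (h2.congr_of_eventuallyEq h3))
    simp at this
    linarith
  have hs := congrArg (fun L : E →L[ℝ] E →L[ℝ] ℝ ↦ L z u) (hsymm x y)
  beta_reduce at hs
  rw [key, key] at hs
  simp only [hG.fderiv_eq hq] at hs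
  rw [hG.symm q hq _ z]
  simp only [hG.coordCurvature_eq hq, map_add, map_sub, _root_.add_apply,
    _root_.sub_apply]
  linarith

/-- The second Bianchi identity. -/
theorem coordCurvature_second_bianchi (hG : IsMetricOn G U) (hq : q ∈ U) (w x y z u : E) :
    fderiv ℝ (fun r ↦ G r (coordCurvature G r x y z) u) q w
      - G q (coordCurvature G q x y (christoffelCLM G q w z)) u
      - G q (coordCurvature G q x y z) (christoffelCLM G q w u)
    + (fderiv ℝ (fun r ↦ G r (coordCurvature G r y w z) u) q x
      - G q (coordCurvature G q y w (christoffelCLM G q x z)) u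
      - G q (coordCurvature G q y w z) (christoffelCLM G q x u))
    + (fderiv ℝ (fun r ↦ G r (coordCurvature G r w x z) u) q y
      - G q (coordCurvature G q w x (christoffelCLM G q y z)) u
      - G q (coordCurvature G q w x z) (christoffelCLM G q y u)) = 0 := by
  have hC := hG.hasFDerivAt_christoffelCLM hq
  have hDC := hG.hasFDerivAt_fderiv_christoffelCLM hq
  have hsymm := (hG.contDiffAt_christoffelCLM hq).isSymmSndFDerivAt two_le_smooth
  have hs (a b c d : E) : fderiv ℝ (fderiv ℝ (christoffelCLM G)) q a b c d =
      fderiv ℝ (fderiv ℝ (christoffelCLM G)) q b a c d :=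
    congrArg (fun L : E →L[ℝ] E →L[ℝ] E ↦ L c d) (hsymm a b)
  -- `fderiv_eq` absorbs the derivative of `G`, which cancels the correction in the slot `u`. In the
  -- cyclic sum the second derivatives of the Christoffel map cancel by symmetry.
  have key (w x y : E) : fderiv ℝ (fun r ↦ G r (coordCurvature G r x y z) u) q w =
      G q (christoffelCLM G q w (coordCurvature G q x y z)) u
      + G q (coordCurvature G q x y z) (christoffelCLM G q w u)
      + G q (fderiv ℝ (fderiv ℝ (christoffelCLM G)) q w x y z
        - fderiv ℝ (fderiv ℝ (christoffelCLM G)) q w y x z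
        + (fderiv ℝ (christoffelCLM G) q w x (christoffelCLM G q y z)
          + christoffelCLM G q x (fderiv ℝ (christoffelCLM G) q w y z))
        - (fderiv ℝ (christoffelCLM G) q w y (christoffelCLM G q x z)
          + christoffelCLM G q y (fderiv ℝ (christoffelCLM G) q w x z))) u := by
    have h1 := ((((hDC.clm_apply_const x).clm_apply_const y).clm_apply_const z).sub
      (((hDC.clm_apply_const y).clm_apply_const x).clm_apply_const z)).add
      ((hC.clm_apply_const x).clm_apply ((hC.clm_apply_const y).clm_apply_const z)) |>.sub
      ((hC.clm_apply_const y).clm_apply ((hC.clm_apply_const x).clm_apply_const z))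
    have h2 : HasFDerivAt (fun r ↦ coordCurvature G r x y z) _ q :=
      h1.congr_of_eventuallyEq (by
        filter_upwards [hG.isOpen.mem_nhds hq] with r hr using hG.coordCurvature_eq hr x y z)
    have h3 := ((hG.hasFDerivAt hq).clm_apply h2).clm_apply_const u
    rw [h3.fderiv, ← hG.fderiv_eq hq]
    simp
    ring
  rw [key, key, key]
  simp only [hG.coordCurvature_eq hq, map_add, map_sub, _root_.add_apply,
    _root_.sub_apply]
  rw [hs x w, hs y w, hs y x]
  ring

/-- Behaviour of the Christoffel map under a change of coordinates. -/
theorem map_christoffelCLM {G' : E → E →L[ℝ] E →L[ℝ] ℝ} {V : Set E} {φ : E → E}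
    (hG : IsMetricOn G U) (hG' : IsMetricOn G' V) (hφ : ContDiffOn ℝ ∞ φ V)
    (hmaps : Set.MapsTo φ V U) (hsurj : ∀ r ∈ V, Function.Surjective (fderiv ℝ φ r))
    (hpull : ∀ r ∈ V, ∀ v w, G' r v w = G (φ r) (fderiv ℝ φ r v) (fderiv ℝ φ r w))
    {r : E} (hr : r ∈ V) (x y : E) :
    fderiv ℝ φ r (christoffelCLM G' r x y) =
      christoffelCLM G (φ r) (fderiv ℝ φ r x) (fderiv ℝ φ r y)
        + fderiv ℝ (fderiv ℝ φ) r x y := by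
  have hφr : ContDiffAt ℝ ∞ φ r := hφ.contDiffAt (hG'.isOpen.mem_nhds hr)
  have hD : HasFDerivAt φ (fderiv ℝ φ r) r := (hφr.differentiableAt (by simp)).hasFDerivAt
  have hD2 : HasFDerivAt (fderiv ℝ φ) (fderiv ℝ (fderiv ℝ φ) r) r :=
    ((hφr.fderiv_right (m := ∞) (by simp)).differentiableAt (by simp)).hasFDerivAt
  have hs (a b : E) : fderiv ℝ (fderiv ℝ φ) r a b = fderiv ℝ (fderiv ℝ φ) r b a :=
    hφr.isSymmSndFDerivAt two_le_smooth a b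
  have hGφ := (hG.hasFDerivAt (hmaps hr)).comp r hD
  have key (a b c : E) : fderiv ℝ G' r a b c =
      fderiv ℝ G (φ r) (fderiv ℝ φ r a) (fderiv ℝ φ r b) (fderiv ℝ φ r c)
        + G (φ r) (fderiv ℝ (fderiv ℝ φ) r a b) (fderiv ℝ φ r c)
        + G (φ r) (fderiv ℝ φ r b) (fderiv ℝ (fderiv ℝ φ) r a c) := by
    have h1 := ((hG'.hasFDerivAt hr).clm_apply_const b).clm_apply_const c
    have h2 := (hGφ.clm_apply (hD2.clm_apply_const b)).clm_apply (hD2.clm_apply_const c)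
    have h3 : (fun r ↦ G' r b c) =ᶠ[nhds r]
        fun r ↦ G (φ r) (fderiv ℝ φ r b) (fderiv ℝ φ r c) := by
      filter_upwards [hG'.isOpen.mem_nhds hr] with r hr using hpull r hr b c
    have := congrArg (fun L : E →L[ℝ] ℝ ↦ L a) (h1.unique (h2.congr_of_eventuallyEq h3))
    simp at this
    linarith
  refine hG.ext (hmaps hr) fun w ↦ ?_
  obtain ⟨w, rfl⟩ := hsurj r hr w
  rw [← hpull r hr, hG'.koszul hr, map_add, _root_.add_apply, hG.koszul (hmaps hr), key, key, key,
    hs y x, hs w x, hs w y, hG.symm _ (hmaps hr) (fderiv ℝ (fderiv ℝ φ) r x w)]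
  ring

/-- The curvature operator is natural under a change of coordinates. -/
theorem map_coordCurvature {G' : E → E →L[ℝ] E →L[ℝ] ℝ} {V : Set E} {φ : E → E}
    (hG : IsMetricOn G U) (hG' : IsMetricOn G' V) (hφ : ContDiffOn ℝ ∞ φ V)
    (hmaps : Set.MapsTo φ V U) (hsurj : ∀ r ∈ V, Function.Surjective (fderiv ℝ φ r))
    (hpull : ∀ r ∈ V, ∀ v w, G' r v w = G (φ r) (fderiv ℝ φ r v) (fderiv ℝ φ r w))
    {r : E} (hr : r ∈ V) (x y z : E) :
    fderiv ℝ φ r (coordCurvature G' r x y z) =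
      coordCurvature G (φ r) (fderiv ℝ φ r x) (fderiv ℝ φ r y) (fderiv ℝ φ r z) := by
  have hφr : ContDiffAt ℝ ∞ φ r := hφ.contDiffAt (hG'.isOpen.mem_nhds hr)
  have hD : HasFDerivAt φ (fderiv ℝ φ r) r := (hφr.differentiableAt (by simp)).hasFDerivAt
  have hφ' : ContDiffAt ℝ ∞ (fderiv ℝ φ) r := hφr.fderiv_right (by simp)
  have hD2 : HasFDerivAt (fderiv ℝ φ) (fderiv ℝ (fderiv ℝ φ) r) r :=
    (hφ'.differentiableAt (by simp)).hasFDerivAt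
  have hD3 : HasFDerivAt (fderiv ℝ (fderiv ℝ φ)) (fderiv ℝ (fderiv ℝ (fderiv ℝ φ)) r) r :=
    ((hφ'.fderiv_right (m := ∞) (by simp)).differentiableAt (by simp)).hasFDerivAt
  have hs2 (a b : E) : fderiv ℝ (fderiv ℝ φ) r a b = fderiv ℝ (fderiv ℝ φ) r b a :=
    hφr.isSymmSndFDerivAt two_le_smooth a b
  have hs3 (a b c : E) : fderiv ℝ (fderiv ℝ (fderiv ℝ φ)) r a b c =
      fderiv ℝ (fderiv ℝ (fderiv ℝ φ)) r b a c :=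
    congrArg (fun L : E →L[ℝ] E ↦ L c) (hφ'.isSymmSndFDerivAt two_le_smooth a b)
  have hC := hG'.hasFDerivAt_christoffelCLM hr
  have hCφ := (hG.hasFDerivAt_christoffelCLM (hmaps hr)).comp r hD
  have hmap {r : E} (hr : r ∈ V) (x y : E) :=
    hG.map_christoffelCLM hG' hφ hmaps hsurj hpull hr x y
  -- Derivative of the transformation law of the Christoffel map. After antisymmetrizing, third
  -- derivatives of `φ` cancel by symmetry; second ones cancel by symmetry or against the quadratic
  -- Christoffel terms.
  have key (a b : E) : fderiv ℝ (fderiv ℝ φ) r a (christoffelCLM G' r b z)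
        + fderiv ℝ φ r (fderiv ℝ (christoffelCLM G') r a b z) =
      fderiv ℝ (christoffelCLM G) (φ r) (fderiv ℝ φ r a) (fderiv ℝ φ r b) (fderiv ℝ φ r z)
        + christoffelCLM G (φ r) (fderiv ℝ (fderiv ℝ φ) r a b) (fderiv ℝ φ r z)
        + christoffelCLM G (φ r) (fderiv ℝ φ r b) (fderiv ℝ (fderiv ℝ φ) r a z)
        + fderiv ℝ (fderiv ℝ (fderiv ℝ φ)) r a b z := by
    have h1 := hD2.clm_apply ((hC.clm_apply_const b).clm_apply_const z)
    have h2 := ((hCφ.clm_apply (hD2.clm_apply_const b)).clm_apply (hD2.clm_apply_const z)).add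
      ((hD3.clm_apply_const b).clm_apply_const z)
    have h3 : (fun r ↦ fderiv ℝ φ r (christoffelCLM G' r b z)) =ᶠ[nhds r]
        ((fun r ↦ christoffelCLM G (φ r) (fderiv ℝ φ r b) (fderiv ℝ φ r z))
          + fun r ↦ fderiv ℝ (fderiv ℝ φ) r b z) := by
      filter_upwards [hG'.isOpen.mem_nhds hr] with r hr using hmap hr b z
    have := congrArg (fun L : E →L[ℝ] E ↦ L a) (h1.unique (h2.congr_of_eventuallyEq h3))
    simp at this
    rw [add_comm, this]
    abel
  have k1 := key x y
  have k2 := key y x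
  rw [← eq_sub_iff_add_eq'] at k1 k2
  rw [hG'.coordCurvature_eq hr, hG.coordCurvature_eq (hmaps hr), map_sub, map_add, map_sub, k1, k2,
    hmap hr, hmap hr, hmap hr, hmap hr, map_add, map_add, hs2 y x, hs3 y x]
  abel

end IsMetricOn

end LeviCivita

/-! ### Constancy of the antiholomorphic sectional curvature in coordinates -/

section Local

set_option maxSynthPendingDepth 3

variable {E : Type*} [NormedAddCommGroup E] [NormedSpace ℝ E]

/-- The difference between the curvature tensor of `G` and the one of constant curvature `ν`. -/
noncomputable def curvatureExcess (G : E → E →L[ℝ] E →L[ℝ] ℝ) (ν : E → ℝ) (q x y z u : E) : ℝ :=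
  G q (coordCurvature G q x y z) u - ν q * (G q x u * G q y z - G q x z * G q y u)

theorem HasFDerivAt.mul_of_eq_zero {f k : E → ℝ} {q : E} (hf : DifferentiableAt ℝ f q)
    (hk : DifferentiableAt ℝ k q) (hf0 : f q = 0) (hk0 : k q = 0) :
    HasFDerivAt (fun r ↦ f r * k r) (0 : E →L[ℝ] ℝ) q :=
  (hf.hasFDerivAt.mul hk.hasFDerivAt).congr_fderiv (by simp [hf0, hk0])

/-- The multiple by `g(a, a)` of the component of `b` orthogonal to `a` and `J a`. -/
noncomputable def antiholomorphicPart (g : E →L[ℝ] E →L[ℝ] ℝ) (J : E →L[ℝ] E) (a b : E) : E :=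
  g a a • b + (-g a b) • a + (-g (J a) b) • J a

theorem antiOrthogonal_antiholomorphicPart {g : E →L[ℝ] E →L[ℝ] ℝ} {J : E →L[ℝ] E}
    (h : IsHermitianPair g J) (a b : E) : AntiOrthogonal g J a (antiholomorphicPart g J a b) := by
  constructor
  · simp [antiholomorphicPart, h.symm a (J a), h.g_J_self]; ring
  · simp [antiholomorphicPart, h.g_J_J, h.g_J_self]; ring

theorem vanishes_curvatureExcess {G : E → E →L[ℝ] E →L[ℝ] ℝ} {q : E} {J : E → E →L[ℝ] E} {ν : E → ℝ}
    (hν : ∀ x y, AntiOrthogonal (G q) (J q) x y →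
      G q (coordCurvature G q x y y) x = ν q * (G q x x * G q y y)) :
    VanishesOnAntiholomorphic (G q) (J q) (curvatureExcess G ν q) := by
  intro x y hxy
  rw [curvatureExcess, hν x y hxy, hxy.1]
  ring

namespace IsMetricOn

variable {G : E → E →L[ℝ] E →L[ℝ] ℝ} {U : Set E} {q : E} {J : E → E →L[ℝ] E} {ν : E → ℝ}
  [FiniteDimensional ℝ E]

theorem isCurvatureLike_curvatureExcess (hG : IsMetricOn G U) (hq : q ∈ U) :
    IsCurvatureLike (curvatureExcess G ν q) where
  add_left x x' y z u := by
    simp only [curvatureExcess, hG.coordCurvature_eq hq, map_add, map_sub, _root_.add_apply,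
      _root_.sub_apply]
    ring
  smul_left c x y z u := by
    simp only [curvatureExcess, hG.coordCurvature_eq hq, map_add, map_sub, map_smul,
      _root_.add_apply, _root_.sub_apply, _root_.smul_apply, smul_eq_mul]
    ring
  swap_left x y z u := by
    simp only [curvatureExcess, hG.coordCurvature_swap_left hq x y, map_neg, _root_.neg_apply]
    ring
  swap_right x y z u := by
    simp only [curvatureExcess, hG.coordCurvature_swap_right hq x y z u]
    ring
  bianchi x y z u := by
    have h1 := congrArg (fun v ↦ G q v u) (hG.coordCurvature_bianchi hq x y z)
    simp only [map_add, _root_.add_apply, map_zero, _root_.zero_apply] at h1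
    simp only [curvatureExcess]
    rw [hG.symm q hq z y, hG.symm q hq z x, hG.symm q hq y x]
    linarith

theorem differentiableAt_curvature (hG : IsMetricOn G U) (hq : q ∈ U) {a b c d : E → E}
    (ha : DifferentiableAt ℝ a q) (hb : DifferentiableAt ℝ b q) (hc : DifferentiableAt ℝ c q)
    (hd : DifferentiableAt ℝ d q) :
    DifferentiableAt ℝ (fun r ↦ G r (coordCurvature G r (a r) (b r) (c r)) (d r)) q := by
  have hGd := (hG.hasFDerivAt hq).differentiableAt
  have hC := (hG.hasFDerivAt_christoffelCLM hq).differentiableAt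
  have hDC := (hG.hasFDerivAt_fderiv_christoffelCLM hq).differentiableAt
  have h1 : DifferentiableAt ℝ (fun r ↦ G r
      (fderiv ℝ (christoffelCLM G) r (a r) (b r) (c r)
        - fderiv ℝ (christoffelCLM G) r (b r) (a r) (c r)
        + christoffelCLM G r (a r) (christoffelCLM G r (b r) (c r))
        - christoffelCLM G r (b r) (christoffelCLM G r (a r) (c r))) (d r)) q := by
    fun_prop
  refine h1.congr_of_eventuallyEq ?_
  filter_upwards [hG.isOpen.mem_nhds hq] with r hr
  rw [hG.coordCurvature_eq hr]

theorem differentiableAt_curvatureExcess (hG : IsMetricOn G U) (hq : q ∈ U)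
    (hν : DifferentiableAt ℝ ν q) {a b c d : E → E}
    (ha : DifferentiableAt ℝ a q) (hb : DifferentiableAt ℝ b q) (hc : DifferentiableAt ℝ c q)
    (hd : DifferentiableAt ℝ d q) :
    DifferentiableAt ℝ (fun r ↦ curvatureExcess G ν r (a r) (b r) (c r) (d r)) q := by
  have hGd := (hG.hasFDerivAt hq).differentiableAt
  have h1 := hG.differentiableAt_curvature hq ha hb hc hd
  exact h1.sub (by fun_prop)

/-- The subtracted tensor is `ν` times a parallel one, so only derivatives of `ν` are added to the
identity for `R`. Corrections in the first two slots are absent because they cancel in the cyclic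
sum by the symmetry of the Christoffel map. -/
theorem second_bianchi_curvatureExcess (hG : IsMetricOn G U) (hq : q ∈ U)
    (hν : DifferentiableAt ℝ ν q) (w x y z u : E) :
    fderiv ℝ (fun r ↦ curvatureExcess G ν r x y z u) q w
      - curvatureExcess G ν q x y (christoffelCLM G q w z) u
      - curvatureExcess G ν q x y z (christoffelCLM G q w u)
      + fderiv ℝ ν q w * (G q x u * G q y z - G q x z * G q y u)
    + (fderiv ℝ (fun r ↦ curvatureExcess G ν r y w z u) q x
      - curvatureExcess G ν q y w (christoffelCLM G q x z) u
      - curvatureExcess G ν q y w z (christoffelCLM G q x u)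
      + fderiv ℝ ν q x * (G q y u * G q w z - G q y z * G q w u))
    + (fderiv ℝ (fun r ↦ curvatureExcess G ν r w x z u) q y
      - curvatureExcess G ν q w x (christoffelCLM G q y z) u
      - curvatureExcess G ν q w x z (christoffelCLM G q y u)
      + fderiv ℝ ν q y * (G q w u * G q x z - G q w z * G q x u)) = 0 := by
  have hb := hG.coordCurvature_second_bianchi hq w x y z u
  have hg (a b : E) := ((hG.hasFDerivAt hq).clm_apply_const a).clm_apply_const b
  have key (w x y : E) : fderiv ℝ (fun r ↦ curvatureExcess G ν r x y z u) q w =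
      fderiv ℝ (fun r ↦ G r (coordCurvature G r x y z) u) q w
      - fderiv ℝ ν q w * (G q x u * G q y z - G q x z * G q y u)
      - ν q * (fderiv ℝ G q w x u * G q y z + G q x u * fderiv ℝ G q w y z
        - fderiv ℝ G q w x z * G q y u - G q x z * fderiv ℝ G q w y u) := by
    have h1 := (hG.differentiableAt_curvature hq (differentiableAt_const x)
      (differentiableAt_const y) (differentiableAt_const z)
      (differentiableAt_const u)).hasFDerivAt
    have h2 : HasFDerivAt (fun r ↦ curvatureExcess G ν r x y z u) _ q :=
      h1.sub (hν.hasFDerivAt.mul (((hg x u).mul (hg y z)).sub ((hg x z).mul (hg y u))))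
    rw [h2.fderiv]
    simp
    ring
  rw [key, key, key]
  simp only [curvatureExcess, hG.fderiv_eq hq]
  rw [hG.christoffelCLM_symm hq x w, hG.christoffelCLM_symm hq y w, hG.christoffelCLM_symm hq y x]
  linear_combination hb

/-- The curvature function of antiholomorphic planes is differentiable. -/
theorem differentiableAt_antiholomorphicCurvature (hG : IsMetricOn G U)
    (hH : ∀ q ∈ U, IsHermitianPair (G q) (J q)) (hJ : DifferentiableAt ℝ J q)
    (hν : ∀ q ∈ U, ∀ x y, AntiOrthogonal (G q) (J q) x y →
      G q (coordCurvature G q x y y) x = ν q * (G q x x * G q y y))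
    (hdim : 6 ≤ Module.finrank ℝ E) (hq : q ∈ U) : DifferentiableAt ℝ ν q := by
  classical
  have hGd := (hG.hasFDerivAt hq).differentiableAt
  have : Nontrivial E := Module.nontrivial_of_finrank_pos (R := ℝ) (by omega)
  obtain ⟨x, hx⟩ := exists_ne (0 : E)
  obtain ⟨y, hy, hxy⟩ := (hH q hq).exists_orthogonal_ne_zero
    (Submodule.span_finset_ne_top ({x, J q x} : Finset E)
      (by have := Finset.card_le_two (a := x) (b := J q x); omega))
  have hxy1 : G q x y = 0 := hxy x (Submodule.subset_span (by simp))
  have hxy2 : G q (J q x) y = 0 := hxy _ (Submodule.subset_span (by simp))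
  -- A differentiable field antiorthogonal to `x` at every point of `U` and nonzero at `q`; near `q`
  -- it exhibits `ν` as a quotient of differentiable functions.
  let Y : E → E := fun r ↦ antiholomorphicPart (G r) (J r) x y
  have hY : DifferentiableAt ℝ Y q := by
    simp only [Y, antiholomorphicPart]
    fun_prop
  have hYq : Y q = G q x x • y := by simp [Y, antiholomorphicPart, hxy1, hxy2]
  have hgx := hG.pos q hq x hx
  have hden : DifferentiableAt ℝ (fun r ↦ G r x x * G r (Y r) (Y r)) q := by fun_prop
  have hden0 : G q x x * G q (Y q) (Y q) ≠ 0 := by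
    have := hG.pos q hq y hy
    rw [hYq]
    simp [hgx.ne', this.ne']
  have hnum := hG.differentiableAt_curvature hq (differentiableAt_const x) hY hY
    (differentiableAt_const x)
  have hdiv := hnum.mul (hden.inv hden0)
  refine hdiv.congr_of_eventuallyEq ?_
  filter_upwards [hG.isOpen.mem_nhds hq, hden.continuousAt.eventually_ne hden0] with r hr hr0
  have hY := hν r hr x (Y r) (antiOrthogonal_antiholomorphicPart (hH r hr) x y)
  simp only [Pi.mul_apply, Pi.inv_apply]
  rw [hY, mul_inv_cancel_right₀ hr0]

/-- The constant vectors `b`, `c` are antiorthogonal to `a` only at `q`. Replacing them by their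
antiholomorphic parts gives a component that vanishes near `q`, and the error is of second order at
`q`. -/
theorem fderiv_curvatureExcess_eq_zero (hG : IsMetricOn G U)
    (hH : ∀ q ∈ U, IsHermitianPair (G q) (J q)) (hJ : DifferentiableAt ℝ J q)
    (hνd : DifferentiableAt ℝ ν q)
    (h0 : ∀ q ∈ U, VanishesOnAntiholomorphic (G q) (J q) (curvatureExcess G ν q))
    (hq : q ∈ U) {a b c : E} (ha0 : a ≠ 0) (hb : AntiOrthogonal (G q) (J q) a b)
    (hc : AntiOrthogonal (G q) (J q) a c)
    (ha : IsPrincipal (G q) (J q) (curvatureExcess G ν q) a) :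
    fderiv ℝ (fun r ↦ curvatureExcess G ν r a b c a) q = 0 := by
  have hGd := (hG.hasFDerivAt hq).differentiableAt
  have hT {r : E} (hr : r ∈ U) := hG.isCurvatureLike_curvatureExcess (ν := ν) hr
  have hJa : DifferentiableAt ℝ (fun r ↦ J r a) q := by fun_prop
  have hca := differentiableAt_const (𝕜 := ℝ) (x := q) a
  have hcb := differentiableAt_const (𝕜 := ℝ) (x := q) b
  have hcc := differentiableAt_const (𝕜 := ℝ) (x := q) c
  have d1 := hG.differentiableAt_curvatureExcess hq hνd hca hcb hcc hca
  have d2 := hG.differentiableAt_curvatureExcess hq hνd hca hcb hJa hca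
  have d3 := hG.differentiableAt_curvatureExcess hq hνd hca hJa hcc hca
  have d4 := hG.differentiableAt_curvatureExcess hq hνd hca hJa hJa hca
  have gb : DifferentiableAt ℝ (fun r ↦ G r (J r a) b) q := by fun_prop
  have gc : DifferentiableAt ℝ (fun r ↦ G r (J r a) c) q := by fun_prop
  have ga : DifferentiableAt ℝ (fun r ↦ G r a a) q := by fun_prop
  have z2 : curvatureExcess G ν q a b (J q a) a = 0 := ha.apply_eq_zero (hH q hq) (hT hq) (h0 q hq)
    hb _
  have z3 : curvatureExcess G ν q a (J q a) c a = 0 := ha c hc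
  have z1 : curvatureExcess G ν q a b c a = 0 := (h0 q hq).polarized (hT hq) hb hc
  -- Expanding the component at the antiholomorphic parts leaves three terms. Each contains two
  -- factors that vanish at `q`: `g(Ja, b)` or `g(Ja, c)`, together with the other one or with a
  -- component of `T` that is zero since `a` is principal.
  have e1 : HasFDerivAt (fun r ↦ G r a a * G r a a * curvatureExcess G ν r a b c a)
      (0 : E →L[ℝ] ℝ) q := by
    have h2 := (HasFDerivAt.mul_of_eq_zero gc d2 hc.2 z2).mul ga.hasFDerivAt
    have h3 := (HasFDerivAt.mul_of_eq_zero gb d3 hb.2 z3).mul ga.hasFDerivAt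
    have h4 := (HasFDerivAt.mul_of_eq_zero gb gc hb.2 hc.2).mul d4.hasFDerivAt
    refine (((h2.add h3).sub h4).congr_of_eventuallyEq ?_).congr_fderiv
      (by simp [hb.2, hc.2])
    filter_upwards [hG.isOpen.mem_nhds hq] with r hr
    have := (h0 r hr).polarized (hT hr) (antiOrthogonal_antiholomorphicPart (hH r hr) a b)
      (antiOrthogonal_antiholomorphicPart (hH r hr) a c)
    simp only [antiholomorphicPart, (hT hr).add₂, (hT hr).add₃, (hT hr).smul₂, (hT hr).smul₃,
      (hT hr).self_left, (hT hr).self_right] at this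
    simp only [Pi.add_apply, Pi.sub_apply, Pi.mul_apply]
    linear_combination this
  have e2 := (ga.hasFDerivAt.mul ga.hasFDerivAt).mul d1.hasFDerivAt
  have e3 := e2.unique e1
  rw [z1, zero_smul, add_zero, smul_eq_zero] at e3
  have hga := (hG.pos q hq a ha0).ne'
  exact e3.resolve_left (by simpa using hga)

/-- In coordinates, pointwise constant antiholomorphic sectional curvature has zero derivative. -/
theorem fderiv_antiholomorphicCurvature_eq_zero (hG : IsMetricOn G U)
    (hH : ∀ q ∈ U, IsHermitianPair (G q) (J q)) (hJ : DifferentiableAt ℝ J q)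
    (hRK : ∀ x y z u, G q (coordCurvature G q x y z) u =
      G q (coordCurvature G q (J q x) (J q y) (J q z)) (J q u))
    (hν : ∀ q ∈ U, ∀ x y, AntiOrthogonal (G q) (J q) x y →
      G q (coordCurvature G q x y y) x = ν q * (G q x x * G q y y))
    (hdim : 6 ≤ Module.finrank ℝ E) (hq : q ∈ U) : HasFDerivAt ν (0 : E →L[ℝ] ℝ) q := by
  have hνd := hG.differentiableAt_antiholomorphicCurvature hH hJ hν hdim hq
  have hT := hG.isCurvatureLike_curvatureExcess (ν := ν) hq
  have h := hH q hq
  have h0 (q : E) (hq : q ∈ U) : VanishesOnAntiholomorphic (G q) (J q) (curvatureExcess G ν q) :=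
    vanishes_curvatureExcess (hν q hq)
  have hTRK (x y z u : E) : curvatureExcess G ν q x y z u =
      curvatureExcess G ν q (J q x) (J q y) (J q z) (J q u) := by
    simp only [curvatureExcess, h.g_J_J, ← hRK x y z u]
  have hcont : Continuous fun x ↦ curvatureExcess G ν q x (J q x) (J q x) x := by
    simp only [curvatureExcess, hG.coordCurvature_eq hq]
    fun_prop
  have hspan := span_isPrincipal_eq_top h hT (h0 q hq) hTRK hcont hdim
  have hker : fderiv ℝ ν q = 0 := by
    refine ContinuousLinearMap.ext_on (s := {a | IsPrincipal (G q) (J q) (curvatureExcess G ν q) a})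
      ?_ fun w hw ↦ ?_
    · rw [hspan]; exact dense_univ
    rcases eq_or_ne w 0 with rfl | hw0
    · simp
    obtain ⟨x, y, hx0, hy0, ht⟩ := exists_isPrincipalTriple h hT (h0 q hq) hTRK hcont hdim hw
    have hxw := ht.wx.symm h
    have hyw := ht.wy.symm h
    have hyx := ht.xy.symm h
    have hd {a b c : E} (ha0 : a ≠ 0) (hb : AntiOrthogonal (G q) (J q) a b)
        (hc : AntiOrthogonal (G q) (J q) a c)
        (ha : IsPrincipal (G q) (J q) (curvatureExcess G ν q) a) :=
      hG.fderiv_curvatureExcess_eq_zero hH hJ hνd h0 hq ha0 hb hc ha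
    have hd' {a b c : E} (ha0 : a ≠ 0) (hb : AntiOrthogonal (G q) (J q) a b)
        (hc : AntiOrthogonal (G q) (J q) a c)
        (ha : IsPrincipal (G q) (J q) (curvatureExcess G ν q) a) :
        fderiv ℝ (fun r ↦ curvatureExcess G ν r a b a c) q = 0 := by
      have he : (fun r ↦ curvatureExcess G ν r a b a c) =ᶠ[nhds q]
          fun r ↦ -curvatureExcess G ν r a b c a := by
        filter_upwards [hG.isOpen.mem_nhds hq] with r hr
        exact (hG.isCurvatureLike_curvatureExcess hr).swap_right _ _ _ _
      rw [he.fderiv_eq, fderiv_fun_neg, hd ha0 hb hc ha, neg_zero]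
    have hd'' : fderiv ℝ (fun r ↦ curvatureExcess G ν r w x y x) q = 0 := by
      have he : (fun r ↦ curvatureExcess G ν r w x y x) =ᶠ[nhds q]
          fun r ↦ -curvatureExcess G ν r x w y x := by
        filter_upwards [hG.isOpen.mem_nhds hq] with r hr
        exact (hG.isCurvatureLike_curvatureExcess hr).swap_left _ _ _ _
      rw [he.fderiv_eq, fderiv_fun_neg, hd hx0 hxw ht.xy ht.principal_x, neg_zero]
    have hz {a b : E} (ha : IsPrincipal (G q) (J q) (curvatureExcess G ν q) a)
        (hab : AntiOrthogonal (G q) (J q) a b) (v : E) :=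
      ha.apply_eq_zero h hT (h0 q hq) hab v
    -- With arguments `w, x, y, y, x`, every derivative and every Christoffel correction vanishes,
    -- leaving `dν(w) g(x, x) g(y, y) = 0`.
    have hb := hG.second_bianchi_curvatureExcess hq hνd w x y y x
    rw [hd hx0 ht.xy ht.xy ht.principal_x, hd' hy0 hyw hyx ht.principal_y, hd'',
      hz ht.principal_x ht.xy, hT.swap_left x y y, hT.swap_right y x y, hz ht.principal_y hyx,
      hT.swap_right y w _ x,
      IsPrincipalTriple.apply_eq_zero h hT (h0 q hq) hy0 hw0 hx0
        ⟨ht.principal_y, ht.principal_w, ht.principal_x, hyw, hyx, ht.wx⟩,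
      hT.swap_right y w y, hz ht.principal_y hyw, hT.swap_left w x _ x, hz ht.principal_x hxw,
      IsPrincipalTriple.apply_eq_zero h hT (h0 q hq) hw0 hx0 hy0 ht,
      ht.xy.1, hyx.1, ht.wx.1, ht.wy.1] at hb
    have h1 := hG.pos q hq x hx0
    have h2 := hG.pos q hq y hy0
    simpa [h1.ne', h2.ne'] using hb
  rw [← hker]
  exact hνd.hasFDerivAt

end IsMetricOn

end Local

/-! ### Charts of an almost Hermitian manifold -/

section Charts

set_option maxSynthPendingDepth 3

variable {E : Type*} [NormedAddCommGroup E] [NormedSpace ℝ E]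
  {M : Type*} [TopologicalSpace M] [ChartedSpace E M] [IsManifold 𝓘(ℝ, E) ∞ M]

/-- The derivative of the inverse of the chart at `p`. -/
noncomputable def chartSymmDeriv (p : M) (q : E) :
    E →L[ℝ] TangentSpace 𝓘(ℝ, E) ((extChartAt 𝓘(ℝ, E) p).symm q) :=
  mfderiv 𝓘(ℝ, E) 𝓘(ℝ, E) (extChartAt 𝓘(ℝ, E) p).symm q

/-- The derivative of the chart at `p`. -/
noncomputable def chartDeriv (p : M) (p' : M) : TangentSpace 𝓘(ℝ, E) p' →L[ℝ] E :=
  mfderiv 𝓘(ℝ, E) 𝓘(ℝ, E) (extChartAt 𝓘(ℝ, E) p) p'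

theorem metricInChart_apply (g : ContMDiffRiemannianMetric 𝓘(ℝ, E) ∞ E
    (fun p : M ↦ TangentSpace 𝓘(ℝ, E) p)) (p : M) (q v w : E) :
    metricInChart g p q v w =
      g.inner ((extChartAt 𝓘(ℝ, E) p).symm q) (chartSymmDeriv p q v) (chartSymmDeriv p q w) := rfl

theorem chartDeriv_chartSymmDeriv {p : M} {q : E} (hq : q ∈ (extChartAt 𝓘(ℝ, E) p).target)
    (v : E) : chartDeriv p ((extChartAt 𝓘(ℝ, E) p).symm q) (chartSymmDeriv p q v) = v := by
  have := mfderiv_extChartAt_comp_mfderivWithin_extChartAt_symm (I := 𝓘(ℝ, E)) hq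
  rw [ModelWithCorners.range_eq_univ, mfderivWithin_univ] at this
  exact congrArg (fun L : E →L[ℝ] E ↦ L v) this

theorem chartSymmDeriv_chartDeriv {p : M} {q : E} (hq : q ∈ (extChartAt 𝓘(ℝ, E) p).target)
    (v : TangentSpace 𝓘(ℝ, E) ((extChartAt 𝓘(ℝ, E) p).symm q)) :
    chartSymmDeriv p q (chartDeriv p ((extChartAt 𝓘(ℝ, E) p).symm q) v) = v := by
  have := mfderivWithin_extChartAt_symm_comp_mfderiv_extChartAt (I := 𝓘(ℝ, E)) hq
  rw [ModelWithCorners.range_eq_univ, mfderivWithin_univ] at this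
  exact congrArg (fun L : TangentSpace 𝓘(ℝ, E) ((extChartAt 𝓘(ℝ, E) p).symm q) →L[ℝ]
    TangentSpace 𝓘(ℝ, E) ((extChartAt 𝓘(ℝ, E) p).symm q) ↦ L v) this

/-- This is the tangent map of the inverse chart along the constant field `v`. -/
theorem contMDiffOn_chartSymmDeriv (p : M) (v : E) :
    ContMDiffOn 𝓘(ℝ, E) 𝓘(ℝ, E).tangent ∞
      (fun q ↦ TotalSpace.mk' E (E := fun p : M ↦ TangentSpace 𝓘(ℝ, E) p)
        ((extChartAt 𝓘(ℝ, E) p).symm q) (chartSymmDeriv p q v))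
      (extChartAt 𝓘(ℝ, E) p).target := by
  have hopen := isOpen_extChartAt_target (I := 𝓘(ℝ, E)) p
  have h1 := (contMDiffOn_extChartAt_symm (I := 𝓘(ℝ, E)) (n := ∞) p).contMDiffOn_tangentMapWithin
    (m := ∞) (by simp) hopen.uniqueMDiffOn
  have h2 : ContMDiff 𝓘(ℝ, E) 𝓘(ℝ, E).tangent ∞
      (fun q : E ↦ (⟨q, v⟩ : TangentBundle 𝓘(ℝ, E) E)) :=
    contMDiff_vectorSpace_iff_contDiff.2 contDiff_const
  refine (h1.comp h2.contMDiffOn fun q hq ↦ hq).congr fun q hq ↦ ?_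
  simp only [Function.comp_def, tangentMapWithin, chartSymmDeriv,
    mfderivWithin_of_isOpen hopen hq]
  rfl

theorem contDiffOn_metricInChart [FiniteDimensional ℝ E]
    (g : ContMDiffRiemannianMetric 𝓘(ℝ, E) ∞ E (fun p : M ↦ TangentSpace 𝓘(ℝ, E) p)) (p : M) :
    ContDiffOn ℝ ∞ (metricInChart g p) (extChartAt 𝓘(ℝ, E) p).target := by
  rw [contDiffOn_clm_apply]
  intro v
  rw [contDiffOn_clm_apply]
  intro w
  rw [← contMDiffOn_iff_contDiffOn]
  intro q hq
  have h : ContMDiffWithinAt 𝓘(ℝ, E) (𝓘(ℝ, E).prod 𝓘(ℝ, ℝ)) ∞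
      (fun q ↦ TotalSpace.mk' ℝ (E := Bundle.Trivial M ℝ) ((extChartAt 𝓘(ℝ, E) p).symm q)
        (g.inner ((extChartAt 𝓘(ℝ, E) p).symm q) (chartSymmDeriv p q v) (chartSymmDeriv p q w)))
      (extChartAt 𝓘(ℝ, E) p).target q := by
    apply ContMDiffWithinAt.clm_bundle_apply₂ (F₁ := E) (F₂ := E)
    · exact ContMDiffAt.comp_contMDiffWithinAt q g.contMDiff.contMDiffAt
        (contMDiffOn_extChartAt_symm (I := 𝓘(ℝ, E)) (n := ∞) p q hq)
    · exact contMDiffOn_chartSymmDeriv p v q hq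
    · exact contMDiffOn_chartSymmDeriv p w q hq
  simp only [contMDiffWithinAt_totalSpace] at h
  exact h.2

theorem isMetricOn_metricInChart [FiniteDimensional ℝ E]
    (g : ContMDiffRiemannianMetric 𝓘(ℝ, E) ∞ E (fun p : M ↦ TangentSpace 𝓘(ℝ, E) p)) (p : M) :
    IsMetricOn (metricInChart g p) (extChartAt 𝓘(ℝ, E) p).target where
  isOpen := isOpen_extChartAt_target p
  contDiffOn := contDiffOn_metricInChart g p
  symm q _ x y := g.symm _ _ _
  pos q hq x hx := g.pos _ _ fun h ↦ hx <| by
    rw [← chartDeriv_chartSymmDeriv hq x]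
    exact (congrArg _ h).trans (map_zero _)

theorem IsMetricOn.mono {G : E → E →L[ℝ] E →L[ℝ] ℝ} {U V : Set E} (hG : IsMetricOn G U)
    (hV : IsOpen V) (hVU : V ⊆ U) : IsMetricOn G V :=
  ⟨hV, hG.contDiffOn.mono hVU, fun q hq ↦ hG.symm q (hVU hq), fun q hq ↦ hG.pos q (hVU hq)⟩

/-- The curvature tensor may be computed in any chart. -/
theorem curvatureTensor_chartSymmDeriv [FiniteDimensional ℝ E]
    (g : ContMDiffRiemannianMetric 𝓘(ℝ, E) ∞ E (fun p : M ↦ TangentSpace 𝓘(ℝ, E) p)) (p : M)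
    {q : E} (hq : q ∈ (extChartAt 𝓘(ℝ, E) p).target) (x y z u : E) :
    curvatureTensor g ((extChartAt 𝓘(ℝ, E) p).symm q) (chartSymmDeriv p q x)
      (chartSymmDeriv p q y) (chartSymmDeriv p q z) (chartSymmDeriv p q u) =
    metricInChart g p q (coordCurvature (metricInChart g p) q x y z) u := by
  set p' := (extChartAt 𝓘(ℝ, E) p).symm q with hp'
  -- Transition to the chart centred at `p'`, in which the curvature at `p'` is defined. It pulls
  -- one metric back to the other, so `map_coordCurvature` applies.
  let τ : E → E := fun r ↦ extChartAt 𝓘(ℝ, E) p' ((extChartAt 𝓘(ℝ, E) p).symm r)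
  let V : Set E := (extChartAt 𝓘(ℝ, E) p).target ∩
    (extChartAt 𝓘(ℝ, E) p).symm ⁻¹' (extChartAt 𝓘(ℝ, E) p').source
  have hV : IsOpen V := (continuousOn_extChartAt_symm p).isOpen_inter_preimage
    (isOpen_extChartAt_target p) (isOpen_extChartAt_source p')
  have hqV : q ∈ V := ⟨hq, mem_extChartAt_source p'⟩
  have hτ : ContDiffOn ℝ ∞ τ V := by
    rw [← contMDiffOn_iff_contDiffOn]
    refine ((contMDiffOn_extChartAt (I := 𝓘(ℝ, E)) (n := ∞) (x := p')).comp
      ((contMDiffOn_extChartAt_symm (I := 𝓘(ℝ, E)) (n := ∞) p).mono Set.inter_subset_left) ?_)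
    intro r hr
    simpa using hr.2
  have hτ' (r : E) (hr : r ∈ V) (v : E) :
      fderiv ℝ τ r v = chartDeriv p' _ (chartSymmDeriv p r v) := by
    have h1 : MDifferentiableAt 𝓘(ℝ, E) 𝓘(ℝ, E) (extChartAt 𝓘(ℝ, E) p')
        ((extChartAt 𝓘(ℝ, E) p).symm r) := mdifferentiableAt_extChartAt (by simpa using hr.2)
    have h2 : MDifferentiableAt 𝓘(ℝ, E) 𝓘(ℝ, E) (extChartAt 𝓘(ℝ, E) p).symm r :=
      (mdifferentiableOn_extChartAt_symm r hr.1).mdifferentiableAt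
        ((isOpen_extChartAt_target p).mem_nhds hr.1)
    have h3 := mfderiv_comp r h1 h2
    rw [mfderiv_eq_fderiv] at h3
    exact congrArg (fun L : E →L[ℝ] E ↦ L v) h3
  have hleft (r : E) (hr : r ∈ V) :
      (extChartAt 𝓘(ℝ, E) p').symm (τ r) = (extChartAt 𝓘(ℝ, E) p).symm r :=
    (extChartAt 𝓘(ℝ, E) p').left_inv hr.2
  have hmaps : Set.MapsTo τ V (extChartAt 𝓘(ℝ, E) p').target := fun r hr ↦
    (extChartAt 𝓘(ℝ, E) p').map_source hr.2
  have hback (r : E) (hr : r ∈ V) (v : E) :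
      (chartSymmDeriv p' (τ r) (fderiv ℝ τ r v) : E) = chartSymmDeriv p r v := by
    have h1 := chartSymmDeriv_chartDeriv (hmaps hr)
    rw [hleft r hr] at h1
    rw [hτ' r hr]
    exact h1 _
  have hinner {a b : M} (hab : a = b) (v w : E) :
      (g.inner a : E →L[ℝ] E →L[ℝ] ℝ) v w = (g.inner b : E →L[ℝ] E →L[ℝ] ℝ) v w := by
    subst hab; rfl
  have hpull (r : E) (hr : r ∈ V) (v w : E) :
      metricInChart g p r v w = metricInChart g p' (τ r) (fderiv ℝ τ r v) (fderiv ℝ τ r w) := by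
    have h1 := hinner (hleft r hr) (chartSymmDeriv p r v) (chartSymmDeriv p r w)
    rw [← hback r hr v, ← hback r hr w] at h1
    refine Eq.trans ?_ h1.symm
    rw [hback r hr v, hback r hr w]
    rfl
  have hsurj (r : E) (hr : r ∈ V) : Function.Surjective (fderiv ℝ τ r) := by
    have hinj : Function.Injective (fderiv ℝ τ r : E →ₗ[ℝ] E) := by
      rw [injective_iff_map_eq_zero]
      intro v hv
      have h1 := hback r hr v
      have h2 : (chartSymmDeriv p r v : E) = 0 := by
        rw [← h1]
        exact (congrArg _ hv).trans (map_zero _)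
      rw [← chartDeriv_chartSymmDeriv hr.1 v]
      exact (congrArg _ h2).trans (map_zero _)
    exact LinearMap.injective_iff_surjective.1 hinj
  have hnat := (isMetricOn_metricInChart g p').map_coordCurvature
    ((isMetricOn_metricInChart g p).mono hV Set.inter_subset_left) hτ hmaps hsurj hpull hqV x y z
  rw [hpull q hqV, hnat, hτ' q hqV, hτ' q hqV, hτ' q hqV, hτ' q hqV]
  rfl

end Charts

/-! ### The almost complex structure in a chart. -/

namespace AlmostHermitianStructure

set_option maxSynthPendingDepth 3

variable {E : Type*} [NormedAddCommGroup E] [NormedSpace ℝ E]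
  {M : Type*} [TopologicalSpace M] [ChartedSpace E M] [IsManifold 𝓘(ℝ, E) ∞ M]

/-- The almost complex structure read in the chart at `p`. -/
noncomputable def complexStructureInChart (S : AlmostHermitianStructure E M) (p : M) (q : E) :
    E →L[ℝ] E :=
  (chartDeriv p ((extChartAt 𝓘(ℝ, E) p).symm q)).comp
    ((S.J ((extChartAt 𝓘(ℝ, E) p).symm q)).comp (chartSymmDeriv p q))

variable (S : AlmostHermitianStructure E M) {p : M} {q : E}

theorem chartSymmDeriv_complexStructureInChart (hq : q ∈ (extChartAt 𝓘(ℝ, E) p).target) (v : E) :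
    chartSymmDeriv p q (S.complexStructureInChart p q v) =
      S.J ((extChartAt 𝓘(ℝ, E) p).symm q) (chartSymmDeriv p q v) :=
  chartSymmDeriv_chartDeriv hq _

theorem isHermitianPair_inChart (hq : q ∈ (extChartAt 𝓘(ℝ, E) p).target) :
    IsHermitianPair (metricInChart S.g p q) (S.complexStructureInChart p q) where
  symm x y := S.g.symm _ _ _
  pos x hx := S.g.pos _ _ fun h ↦ hx <| by
    rw [← chartDeriv_chartSymmDeriv hq x]
    exact (congrArg _ h).trans (map_zero _)
  J_J x := by
    have h := S.chartSymmDeriv_complexStructureInChart hq (S.complexStructureInChart p q x)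
    rw [S.chartSymmDeriv_complexStructureInChart hq x, S.J_J] at h
    rw [← chartDeriv_chartSymmDeriv hq (S.complexStructureInChart p q _), h, map_neg,
      chartDeriv_chartSymmDeriv hq]
  g_J_J x y := by
    rw [metricInChart_apply, S.chartSymmDeriv_complexStructureInChart hq,
      S.chartSymmDeriv_complexStructureInChart hq, S.g_J_J]
    rfl

theorem differentiableAt_complexStructureInChart [FiniteDimensional ℝ E]
    (hq : q ∈ (extChartAt 𝓘(ℝ, E) p).target) :
    DifferentiableAt ℝ (S.complexStructureInChart p) q := by
  have hopen := isOpen_extChartAt_target (I := 𝓘(ℝ, E)) p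
  have hsource := isOpen_extChartAt_source (I := 𝓘(ℝ, E)) p
  suffices h : ContDiffOn ℝ ∞ (S.complexStructureInChart p) (extChartAt 𝓘(ℝ, E) p).target from
    (h.contDiffAt (hopen.mem_nhds hq)).differentiableAt (by simp)
  rw [contDiffOn_clm_apply]
  intro v q hq
  have h1 : ContMDiffWithinAt 𝓘(ℝ, E) 𝓘(ℝ, E).tangent ∞
      (fun q ↦ TotalSpace.mk' E (E := fun p : M ↦ TangentSpace 𝓘(ℝ, E) p)
        ((extChartAt 𝓘(ℝ, E) p).symm q)
        (S.J ((extChartAt 𝓘(ℝ, E) p).symm q) (chartSymmDeriv p q v)))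
      (extChartAt 𝓘(ℝ, E) p).target q := by
    apply ContMDiffWithinAt.clm_bundle_apply (F₁ := E) (F₂ := E)
    · exact ContMDiffAt.comp_contMDiffWithinAt q S.contMDiff_J.contMDiffAt
        (contMDiffOn_extChartAt_symm (I := 𝓘(ℝ, E)) (n := ∞) p q hq)
    · exact contMDiffOn_chartSymmDeriv p v q hq
  have h2 := ((contMDiffOn_extChartAt (I := 𝓘(ℝ, E)) (n := ∞) (x := p)).mono
    (extChartAt_source 𝓘(ℝ, E) p).subset).contMDiffOn_tangentMapWithin
    (m := ∞) (by simp) hsource.uniqueMDiffOn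
  have h3 := (h2 _ (by exact (extChartAt 𝓘(ℝ, E) p).map_target hq)).comp q h1
    fun r hr ↦ (extChartAt 𝓘(ℝ, E) p).map_target hr
  rw [contMDiffWithinAt_totalSpace] at h3
  refine (contMDiffWithinAt_iff_contDiffWithinAt.1 h3.2).congr_of_mem (fun r hr ↦ ?_) hq
  simp only [Function.comp_apply, tangentMapWithin,
    mfderivWithin_of_isOpen hsource ((extChartAt 𝓘(ℝ, E) p).map_target hr)]
  simp
  rfl

end AlmostHermitianStructure

/-! ### Curvature hypotheses in a chart and local constancy. -/

namespace AlmostHermitianStructure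

set_option maxSynthPendingDepth 3

variable {E : Type*} [NormedAddCommGroup E] [NormedSpace ℝ E] [FiniteDimensional ℝ E]
  {M : Type*} [TopologicalSpace M] [ChartedSpace E M] [IsManifold 𝓘(ℝ, E) ∞ M]
  (S : AlmostHermitianStructure E M) {p : M} {q : E}

/-- The hypothesis concerns orthonormal pairs; both sides are quadratic in `x` and in `y`, so
normalizing suffices. -/
theorem curvature_inChart_of_antiOrthogonal {c : ℝ}
    (hc : ∀ x y, S.IsHolomorphicBasis (Real.pi / 2) ((extChartAt 𝓘(ℝ, E) p).symm q) x y →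
      curvatureTensor S.g ((extChartAt 𝓘(ℝ, E) p).symm q) x y y x = c)
    (hq : q ∈ (extChartAt 𝓘(ℝ, E) p).target) {x y : E}
    (hxy : AntiOrthogonal (metricInChart S.g p q) (S.complexStructureInChart p q) x y) :
    metricInChart S.g p q (coordCurvature (metricInChart S.g p) q x y y) x =
      c * (metricInChart S.g p q x x * metricInChart S.g p q y y) := by
  have h := S.isHermitianPair_inChart hq
  -- With `ν = 0` the excess is the curvature itself, which gives its multilinearity.
  have hT := (isMetricOn_metricInChart S.g p).isCurvatureLike_curvatureExcess (ν := 0) hq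
  have hT0 (x y z u : E) : curvatureExcess (metricInChart S.g p) 0 q x y z u =
      metricInChart S.g p q (coordCurvature (metricInChart S.g p) q x y z) u := by
    simp [curvatureExcess]
  rw [← hT0]
  rcases eq_or_ne x 0 with rfl | hx
  · have := hT.smul_left 0 0 y y 0
    simpa using this
  rcases eq_or_ne y 0 with rfl | hy
  · have := hT.smul₂ 0 x 0 0 x
    simpa using this
  have hgx := h.pos x hx
  have hgy := h.pos y hy
  set G := metricInChart S.g p q with hG
  have hsx := Real.sqrt_pos.2 hgx
  have hsy := Real.sqrt_pos.2 hgy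
  have hx2 := Real.mul_self_sqrt hgx.le
  have hy2 := Real.mul_self_sqrt hgy.le
  set s := √(G x x)
  set t := √(G y y)
  have hbasis : S.IsHolomorphicBasis (Real.pi / 2) ((extChartAt 𝓘(ℝ, E) p).symm q)
      (chartSymmDeriv p q (s⁻¹ • x)) (chartSymmDeriv p q (t⁻¹ • y)) := by
    refine ⟨?_, ?_, ?_, ?_⟩
    · rw [← metricInChart_apply, ← hG]
      simp only [map_smul, _root_.smul_apply, smul_eq_mul]
      rw [← hx2]; field_simp
    · rw [← metricInChart_apply, ← hG]
      simp only [map_smul, _root_.smul_apply, smul_eq_mul]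
      rw [← hy2]; field_simp
    · rw [← metricInChart_apply, ← hG]
      simp [hxy.1]
    · rw [← S.chartSymmDeriv_complexStructureInChart hq, ← metricInChart_apply, ← hG]
      have := (hxy.symm h).2
      rw [h.symm] at this
      simp [this]
  have := hc _ _ hbasis
  rw [curvatureTensor_chartSymmDeriv S.g p hq, ← hT0] at this
  simp only [hT.smul_left, hT.smul₂, hT.smul₃, hT.smul₄] at this
  rw [← this, ← hx2, ← hy2]
  field_simp

theorem isRK_inChart (hRK : S.IsRK) (hq : q ∈ (extChartAt 𝓘(ℝ, E) p).target) (x y z u : E) :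
    metricInChart S.g p q (coordCurvature (metricInChart S.g p) q x y z) u =
      metricInChart S.g p q (coordCurvature (metricInChart S.g p) q
        (S.complexStructureInChart p q x) (S.complexStructureInChart p q y)
        (S.complexStructureInChart p q z)) (S.complexStructureInChart p q u) := by
  rw [← curvatureTensor_chartSymmDeriv S.g p hq, ← curvatureTensor_chartSymmDeriv S.g p hq, hRK]
  simp only [S.chartSymmDeriv_complexStructureInChart hq]

/-- The pointwise antiholomorphic sectional curvature of an RK-manifold of dimension at least six
is locally constant. -/
theorem isLocallyConstant_antiholomorphicCurvature (hdim : 6 ≤ Module.finrank ℝ E) (hRK : S.IsRK)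
    {ν : M → ℝ} (hν : ∀ p x y, S.IsHolomorphicBasis (Real.pi / 2) p x y →
      curvatureTensor S.g p x y y x = ν p) : IsLocallyConstant ν := by
  rw [IsLocallyConstant.iff_eventually_eq]
  intro p
  have hopen := isOpen_extChartAt_target (I := 𝓘(ℝ, E)) p
  have hzero (q : E) (hq : q ∈ (extChartAt 𝓘(ℝ, E) p).target) :
      HasFDerivAt (fun q ↦ ν ((extChartAt 𝓘(ℝ, E) p).symm q)) (0 : E →L[ℝ] ℝ) q :=
    (isMetricOn_metricInChart S.g p).fderiv_antiholomorphicCurvature_eq_zero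
      (fun q hq ↦ S.isHermitianPair_inChart hq)
      (S.differentiableAt_complexStructureInChart hq) (S.isRK_inChart hRK hq)
      (fun q hq x y hxy ↦ S.curvature_inChart_of_antiOrthogonal (hν _) hq hxy) hdim hq
  obtain ⟨ε, hε, hball⟩ := Metric.isOpen_iff.1 hopen _ (mem_extChartAt_target p)
  have hconst : ∀ q ∈ Metric.ball (extChartAt 𝓘(ℝ, E) p p) ε,
      ν ((extChartAt 𝓘(ℝ, E) p).symm q) =
        ν ((extChartAt 𝓘(ℝ, E) p).symm (extChartAt 𝓘(ℝ, E) p p)) := fun q hq ↦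
    Metric.isOpen_ball.is_const_of_fderiv_eq_zero (𝕜 := ℝ)
      (convex_ball _ _).isPreconnected
      (fun r hr ↦ (hzero r (hball hr)).differentiableAt.differentiableWithinAt)
      (fun r hr ↦ (hzero r (hball hr)).fderiv) hq (Metric.mem_ball_self hε)
  filter_upwards [(continuousAt_extChartAt (I := 𝓘(ℝ, E)) p).preimage_mem_nhds
    (Metric.ball_mem_nhds _ hε), extChartAt_source_mem_nhds (I := 𝓘(ℝ, E)) p] with p' h1 h2
  have := hconst _ h1
  rwa [(extChartAt 𝓘(ℝ, E) p).left_inv h2,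
    (extChartAt 𝓘(ℝ, E) p).left_inv (mem_extChartAt_source p)] at this

end AlmostHermitianStructure

theorem mainTheorem2 {E : Type*} [NormedAddCommGroup E] [NormedSpace ℝ E] [FiniteDimensional ℝ E]
    {M : Type*} [TopologicalSpace M] [ChartedSpace E M] [IsManifold 𝓘(ℝ, E) ∞ M]
    [ConnectedSpace M] (m : ℕ) (hdim : Module.finrank ℝ E = 2 * m) (hm : 6 ≤ 2 * m)
    (S : AlmostHermitianStructure E M) (hRK : S.IsRK)
    (hν : S.IsPointwiseConstantAntiholomorphicCurvature) :
    S.IsConstantAntiholomorphicCurvature := by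
  choose ν hν using hν
  obtain ⟨p₀⟩ := (inferInstance : Nonempty M)
  refine ⟨ν p₀, fun p x y hxy ↦ ?_⟩
  rw [hν p x y hxy]
  exact (S.isLocallyConstant_antiholomorphicCurvature (hdim ▸ hm) hRK hν).apply_eq_of_isPreconnected
    isPreconnected_univ (Set.mem_univ p) (Set.mem_univ p₀)
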